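/- **Setting.** Let $R$ be a commutative noetherian ring, let $A=R[[t_1,\dots,t_m]][x_1,\dots,x_n]$, and let $>$ be a $t$-local monomial ordering on the module monomials $t^\beta x^\alpha e_i$ of $A^s$, i.e. a strict total ordering that is compatible with multiplication by monomials, restricts to the same ordering on the monomials $t^\beta x^\alpha$ in every component (again denoted by $>$), and satisfies $e_i>t^\beta e_i$ for all $i$ and all $\beta\neq 0$. For $0\ne f\in A^s$ let $\mathrm{lm}(f)$, $\mathrm{lc}(f)$, $\mathrm{lt}(f)=\mathrm{lc}(f)\,\mathrm{lm}(f)$ be the leading monomial, coefficient and term, and put $\mathrm{lt}(0)=0$, $\mathrm{lm}(0)=-\infty$. For a subset $B$ let $\mathrm{LT}_>(B)$ be the $R[t,x]$-submodule of $R[t,x]^s$ generated by all $\mathrm{lt}(f)$, $f\in B$. Let $A_>=S_>^{-1}A$ with $S_>=\{u\in A: \mathrm{lt}(u)=1\}$; for $f\in A_>^s$ one defines $\mathrm{lt}(f):=\mathrm{lt}(uf)$ for any $u\in S_>$ with $uf\in A^s$, and then leading modules as before. A finite subset $B$ of a submodule $M\le A_>^s$ is a *standard basis* of $M$ if $\mathrm{LT}_>(B)=\mathrm{LT}_>(M)$.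 A *weak division with remainder* of $f\in A^s$ with respect to $g_1,\dots,g_l\in A^s$ is an equation $u f=q_1g_1+\dots+q_lg_l+r$ with $u\in S_>$, $q_i\in A$, $r\in A^s$, such that $\mathrm{lm}(q_i)\,\mathrm{lm}(g_i)\le\mathrm{lm}(f)$ whenever $q_i\neq0$ and $g_i\ne 0$, and $\mathrm{lt}(r)\notin\langle \mathrm{lt}(g_1),\dots,\mathrm{lt}(g_l)\rangle_{R[t,x]}$ unless $r=0$. **Data.** Let $G=(g_1,\dots,g_k)$ be a tuple of nonzero elements of $A^s$. Let $\varphi$ be the homomorphism $\varepsilon_i\mapsto g_i$ (from $A^k$ to $A^s$ and from $A_>^k$ to $A_>^s$), where $\varepsilon_1,\dots,\varepsilon_k$ is the standard basis, and let $\mathrm{syz}(G)\le A_>^k$ be its kernel over $A_>$. The Schreyer ordering $>_S$ on the module monomials of $A^k$ is given by: $p\,\varepsilon_i>_S q\,\varepsilon_j$ iff $p\,\mathrm{lm}(g_i)>q\,\mathrm{lm}(g_j)$, or $p\,\mathrm{lm}(g_i)=q\,\mathrm{lm}(g_j)$ and $i>j$. For $1\le l\le k$: * Let $C_l$ be the set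 of all least common multiples of $(\mathrm{lm}(g_i))_{i\in J}$, where $J\subseteq\{1,\dots,k\}$, $\max J=l$ and all $\mathrm{lm}(g_i)$, $i\in J$, lie in the same component. For $a\in C_l$ let $J_{l,a}=\{i\le l:\mathrm{lm}(g_i)\text{ divides }a\}$, and choose a finite generating set $S_{R,l,a}$ of the $R$-module $\{(c_i)_{i\in J_{l,a}} : \sum_i c_i\,\mathrm{lc}(g_i)=0\}$. * Let $\mathrm{syz}_l\subseteq A^k$ be the set of all $\sum_{i\in J_{l,a}}c_i\frac{a}{\mathrm{lm}(g_i)}\varepsilon_i$ with $a\in C_l$ and $c\in S_{R,l,a}$, $c_l\ne0$. * For every $\xi'\in\mathrm{syz}_l$ fix one weak division with remainder $u\,\varphi(\xi')=q_1g_1+\dots+q_lg_l+r$ of $\varphi(\xi')$ with respect to $g_1,\dots,g_l$, and let $\mathfrak S_l$ be the set of the resulting elements $u\,\xi'-\sum_{i=1}^l q_i\varepsilon_i\in A^k$. **Theorem.** Suppose that $\mathfrak S\subseteq\bigcup_{l=1}^k\mathfrak S_l$ satisfies $\mathrm{LT}_{>_S}(\mathfrak S)=\mathrm{LT}_{>_S}\big(\bigcup_{l=1}^k\mathfrak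 S_l\big)$ and $\varphi(\xi)=0$ for all $\xi\in\mathfrak S$. Then $G$ is a standard basis with respect to $>$, that is, $\{g_1,\dots,g_k\}$ is a standard basis of the submodule of $A_>^s$ generated by $g_1,\dots,g_k$; and $\mathfrak S$ is a standard basis of $\mathrm{syz}(G)$ with respect to $>_S$. -/

import Mathlib

namespace MixedStd

noncomputable section

/-- The ring `R[[t_1,…,t_m]][x_1,…,x_n]`. -/
abbrev MixedRing (R : Type*) [CommRing R] (m n : ℕ) : Type _ :=
  MvPolynomial (Fin n) (MvPowerSeries (Fin m) R)

/-- The polynomial ring `R[t, x]`. -/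
abbrev PolyRing (R : Type*) [CommRing R] (m n : ℕ) : Type _ :=
  MvPolynomial (Fin m ⊕ Fin n) R

/-- The monomials `t^β x^α`, given by their exponent vectors `(β, α)` and written additively. -/
abbrev Mon (m n : ℕ) : Type := Fin m ⊕ Fin n →₀ ℕ

/-- The exponent vector of the `t`-part of a monomial. -/
def Mon.tPart {m n : ℕ} (p : Mon m n) : Fin m →₀ ℕ :=
  (Finsupp.sumFinsuppEquivProdFinsupp p).1

/-- The exponent vector of the `x`-part of a monomial. -/
def Mon.xPart {m n : ℕ} (p : Mon m n) : Fin n →₀ ℕ :=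
  (Finsupp.sumFinsuppEquivProdFinsupp p).2

/-- The monomial `t^β`. -/
def tMon {m : ℕ} (n : ℕ) (β : Fin m →₀ ℕ) : Mon m n :=
  Finsupp.sumFinsuppEquivProdFinsupp.symm (β, 0)

/-- The module monomials `t^β x^α · e_i`. -/
@[ext]
structure ModMon (m n s : ℕ) where
  mon : Mon m n
  comp : Fin s

/-- The action of monomials on module monomials. -/
def ModMon.act {m n s : ℕ} (p : Mon m n) (a : ModMon m n s) : ModMon m n s :=
  ⟨p + a.mon, a.comp⟩

/-- Divisibility of module monomials. -/
def ModMon.Divides {m n s : ℕ} (a b : ModMon m n s) : Prop :=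
  a.comp = b.comp ∧ a.mon ≤ b.mon

/-- A `t`-local monomial ordering on the module monomials: a strict total ordering compatible with
multiplication by monomials, restricting to the same ordering in every component, and with
`1 · e_i > t^β · e_i` for `β ≠ 0`. -/
structure TLocalOrder (m n s : ℕ) where
  gt : ModMon m n s → ModMon m n s → Prop
  irrefl : ∀ a, ¬ gt a a
  trans : ∀ a b c, gt a b → gt b c → gt a c
  total : ∀ a b, gt a b ∨ a = b ∨ gt b a
  act_gt : ∀ (p : Mon m n) (a b : ModMon m n s), gt a b → gt (a.act p) (b.act p)
  comp_iff : ∀ (p q : Mon m n) (i j : Fin s), gt ⟨p, i⟩ ⟨q, i⟩ ↔ gt ⟨p, j⟩ ⟨q, j⟩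
  tLocal : ∀ (β : Fin m →₀ ℕ) (i : Fin s), β ≠ 0 → gt ⟨0, i⟩ ⟨tMon n β, i⟩

/-- The monomial ordering on the monomials of the ring to which the module ordering restricts in
each component. -/
def TLocalOrder.ringGt {m n s : ℕ} (o : TLocalOrder m n s) (p q : Mon m n) : Prop :=
  ∀ i : Fin s, o.gt ⟨p, i⟩ ⟨q, i⟩

section Coefficients

variable {R : Type*} [CommRing R] {m n s : ℕ}

/-- The coefficient of `f` at `t^β x^α`. -/
def coeffAt (f : MixedRing R m n) (p : Mon m n) : R :=
  MvPowerSeries.coeff p.tPart (MvPolynomial.coeff p.xPart f)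

/-- The term `c · t^β x^α`. -/
def mixedTerm (p : Mon m n) (c : R) : MixedRing R m n :=
  MvPolynomial.monomial p.xPart (MvPowerSeries.monomial p.tPart c)

/-- The coefficient of an element of the free module at a module monomial. -/
def modCoeff (f : Fin s → MixedRing R m n) (a : ModMon m n s) : R :=
  coeffAt (f a.comp) a.mon

/-- `a` is the largest module monomial occurring in `f`. -/
def IsLeadMon (o : TLocalOrder m n s) (f : Fin s → MixedRing R m n) (a : ModMon m n s) : Prop :=
  modCoeff f a ≠ 0 ∧ ∀ b, modCoeff f b ≠ 0 → b = a ∨ o.gt a b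

/-- `p` is the largest monomial occurring in `f`. -/
def IsRingLeadMon (o : TLocalOrder m n s) (f : MixedRing R m n) (p : Mon m n) : Prop :=
  coeffAt f p ≠ 0 ∧ ∀ q, coeffAt f q ≠ 0 → q = p ∨ o.ringGt p q

end Coefficients

theorem coeffAt_mk {R : Type*} [CommRing R] {m n : ℕ} (f : MixedRing R m n)
    (β : Fin m →₀ ℕ) (α : Fin n →₀ ℕ) :
    coeffAt f (Finsupp.sumFinsuppEquivProdFinsupp.symm (β, α)) =
      MvPowerSeries.coeff β (MvPolynomial.coeff α f) := by
  simp [coeffAt, Mon.tPart, Mon.xPart]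

theorem exists_modCoeff_ne_zero {R : Type*} [CommRing R] {m n s : ℕ}
    (f : Fin s → MixedRing R m n) (hf : f ≠ 0) : ∃ a, modCoeff f a ≠ 0 := by
  by_contra! h
  apply hf
  funext i
  refine MvPolynomial.ext _ _ fun α => MvPowerSeries.ext fun β => ?_
  have := h ⟨Finsupp.sumFinsuppEquivProdFinsupp.symm (β, α), i⟩
  simp only [modCoeff, coeffAt_mk] at this
  simpa using this

/-- Leading monomials of nonzero elements exist, because the ordering is `t`-local. -/
theorem exists_isLeadMon {R : Type*} [CommRing R] {m n s : ℕ} (o : TLocalOrder m n s)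
    (f : Fin s → MixedRing R m n) (hf : f ≠ 0) : ∃ a, IsLeadMon o f a := by
  classical
  -- it suffices that the inverse ordering is well-founded on the monomials of `f`
  have key : WellFounded (fun a b : {a : ModMon m n s // modCoeff f a ≠ 0} => o.gt a.1 b.1) := by
    have : Std.Irrefl (fun a b : {a : ModMon m n s // modCoeff f a ≠ 0} => o.gt a.1 b.1) :=
      ⟨fun a => o.irrefl _⟩
    have : IsTrans {a : ModMon m n s // modCoeff f a ≠ 0} (fun a b => o.gt a.1 b.1) :=
      ⟨fun a b c => o.trans _ _ _⟩
    have : IsStrictOrder {a : ModMon m n s // modCoeff f a ≠ 0} (fun a b => o.gt a.1 b.1) := ⟨⟩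
    rw [RelEmbedding.wellFounded_iff_isEmpty]
    refine ⟨fun e => ?_⟩
    have hmono : ∀ i j : ℕ, i < j → o.gt (e j).1 (e i).1 := fun i j hij => e.map_rel_iff.2 hij
    -- only finitely many components and `x`-parts occur
    let F : ℕ → (j : Fin s) × ((f j).support) := fun i =>
      ⟨(e i).1.comp, ⟨(e i).1.mon.xPart, by
        rw [MvPolynomial.mem_support_iff]
        intro h0
        exact (e i).2 (by rw [modCoeff, coeffAt, h0, map_zero])⟩⟩
    obtain ⟨y, hy⟩ := Finite.exists_infinite_fiber F
    have hinf : (F ⁻¹' {y}).Infinite := Set.infinite_coe_iff.1 hy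
    let sub := Nat.orderEmbeddingOfSet (F ⁻¹' {y})
    have hsub : ∀ i, F (sub i) = y := fun i => (Nat.orderEmbeddingOfSet_range (F ⁻¹' {y}) ▸
      Set.mem_range_self i : sub i ∈ F ⁻¹' {y})
    obtain ⟨i, j, hij, hle⟩ := wellQuasiOrdered_le (α := Fin m →₀ ℕ)
      (fun i => (e (sub i)).1.mon.tPart)
    have hF : F (sub i) = F (sub j) := (hsub i).trans (hsub j).symm
    have hcomp : (e (sub i)).1.comp = (e (sub j)).1.comp := congrArg Sigma.fst hF
    have hx : (e (sub i)).1.mon.xPart = (e (sub j)).1.mon.xPart :=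
      congrArg (fun z : (j : Fin s) × ((f j).support) => (z.2 : Fin n →₀ ℕ)) hF
    have hgt := hmono _ _ (sub.strictMono hij)
    generalize (e (sub i)).1 = a at *
    generalize (e (sub j)).1 = b at *
    obtain ⟨p, c⟩ := a
    obtain ⟨q, c'⟩ := b
    simp only at hcomp hx hle
    subst hcomp
    have hq : q = p + tMon n (q.tPart - p.tPart) := by
      apply Finsupp.sumFinsuppEquivProdFinsupp.injective
      apply Prod.ext
      · ext v
        have := hle v
        simp [Mon.tPart, tMon] at this ⊢
        omega
      · ext v
        have := DFunLike.congr_fun hx v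
        simp [Mon.xPart, tMon] at this ⊢
        exact this.symm
    by_cases h0 : q.tPart - p.tPart = 0
    · have : q = p := by
        rw [hq, h0]
        simp [tMon]
      subst this
      exact o.irrefl _ hgt
    · have h1 := o.act_gt p _ _ (o.tLocal _ c h0)
      simp only [ModMon.act, add_zero] at h1
      rw [← hq] at h1
      exact o.irrefl _ (o.trans _ _ _ h1 hgt)
  obtain ⟨a₀, ha₀⟩ := exists_modCoeff_ne_zero f hf
  obtain ⟨a, -, ha⟩ := key.has_min Set.univ ⟨⟨a₀, ha₀⟩, trivial⟩
  refine ⟨a.1, a.2, fun b hb => ?_⟩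
  rcases o.total a.1 b with h | h | h
  · exact Or.inr h
  · exact Or.inl h.symm
  · exact absurd h (ha ⟨b, hb⟩ trivial)

section Leading

variable {R : Type*} [CommRing R] {m n s : ℕ}

/-- The leading monomial of a nonzero element. -/
def leadMon (o : TLocalOrder m n s) (f : Fin s → MixedRing R m n) (hf : f ≠ 0) : ModMon m n s :=
  (exists_isLeadMon o f hf).choose

/-- The leading coefficient of a nonzero element. -/
def leadCoeff (o : TLocalOrder m n s) (f : Fin s → MixedRing R m n) (hf : f ≠ 0) : R :=
  modCoeff f (leadMon o f hf)

open Classical in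
/-- The leading term, as an element of `R[t, x]^s`; it is `0` for `f = 0`. -/
def leadTerm (o : TLocalOrder m n s) (f : Fin s → MixedRing R m n) : Fin s → PolyRing R m n :=
  if hf : f ≠ 0 then
    Pi.single (leadMon o f hf).comp
      (MvPolynomial.monomial (leadMon o f hf).mon (leadCoeff o f hf))
  else 0

/-- The `R[t, x]`-submodule of `R[t, x]^s` generated by the leading terms of the elements
of `B`. -/
def leadModule (o : TLocalOrder m n s) (B : Set (Fin s → MixedRing R m n)) :
    Submodule (PolyRing R m n) (Fin s → PolyRing R m n) :=
  Submodule.span (PolyRing R m n) (leadTerm o '' B)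

/-- `f = ∑_{i ∈ I} q_i g_i + r` is a division with remainder of `f` with respect to
`(g_i)_{i ∈ I}`:
`lm(q_i) · lm(g_i) ≤ lm(f)` for all `i ∈ I` with `q_i, g_i ≠ 0` (which in particular excludes
`f = 0` as soon as such an `i` exists), and `lt(r)` is not in the module generated by the
`lt(g_i)`, unless `r = 0`. -/
structure IsDivision {k : ℕ} (o : TLocalOrder m n s) (g : Fin k → Fin s → MixedRing R m n)
    (I : Finset (Fin k)) (f : Fin s → MixedRing R m n) (q : Fin k → MixedRing R m n)
    (r : Fin s → MixedRing R m n) : Prop where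
  eq : f = ∑ i ∈ I, q i • g i + r
  id1 : ∀ i ∈ I, ∀ p a, IsRingLeadMon o (q i) p → IsLeadMon o (g i) a →
    ∃ b, IsLeadMon o f b ∧ ¬ o.gt (a.act p) b
  id2 : r ≠ 0 → leadTerm o r ∉ leadModule o (g '' (I : Set (Fin k)))

end Leading

section Localization

variable {m n s : ℕ}

theorem coeffAt_one (R : Type*) [CommRing R] (p : Mon m n) :
    coeffAt (1 : MixedRing R m n) p = if p = 0 then 1 else 0 := by
  classical
  have hp : p = 0 ↔ 0 = p.xPart ∧ p.tPart = 0 := by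
    constructor
    · rintro rfl
      constructor <;> ext <;> simp [Mon.xPart, Mon.tPart]
    · rintro ⟨h1, h2⟩
      ext v
      rcases v with v | v
      · simpa [Mon.tPart] using DFunLike.congr_fun h2 v
      · simpa [Mon.xPart] using (DFunLike.congr_fun h1 v).symm
  simp only [coeffAt, MvPolynomial.coeff_one, hp]
  split_ifs with h1 h2 h2
  · simp [MvPowerSeries.coeff_one, h2.2]
  · have : p.tPart ≠ 0 := fun h => h2 ⟨h1, h⟩
    simp [MvPowerSeries.coeff_one, this]
  · exact absurd h2.1 h1
  · simp

theorem coeffAt_mul_ne_zero {R : Type*} [CommRing R] (f g : MixedRing R m n) (p : Mon m n)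
    (h : coeffAt (f * g) p ≠ 0) :
    ∃ q r : Mon m n, q + r = p ∧ coeffAt f q ≠ 0 ∧ coeffAt g r ≠ 0 := by
  classical
  simp only [coeffAt, MvPolynomial.coeff_mul, map_sum, MvPowerSeries.coeff_mul] at h
  obtain ⟨x, hx, h⟩ := Finset.exists_ne_zero_of_sum_ne_zero h
  obtain ⟨y, hy, h⟩ := Finset.exists_ne_zero_of_sum_ne_zero h
  rw [Finset.HasAntidiagonal.mem_antidiagonal] at hx hy
  refine ⟨Finsupp.sumFinsuppEquivProdFinsupp.symm (y.1, x.1),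
    Finsupp.sumFinsuppEquivProdFinsupp.symm (y.2, x.2), ?_, ?_, ?_⟩
  · ext v
    rcases v with v | v
    · simpa [Mon.tPart] using DFunLike.congr_fun hy v
    · simpa [Mon.xPart] using DFunLike.congr_fun hx v
  · rw [coeffAt_mk]
    exact left_ne_zero_of_mul h
  · rw [coeffAt_mk]
    exact right_ne_zero_of_mul h

theorem coeffAt_zero_mul {R : Type*} [CommRing R] (f g : MixedRing R m n) :
    coeffAt (f * g) 0 = coeffAt f 0 * coeffAt g 0 := by
  have h1 : (0 : Mon m n).xPart = 0 := by ext; simp [Mon.xPart]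
  have h2 : (0 : Mon m n).tPart = 0 := by ext; simp [Mon.tPart]
  simp [coeffAt, h1, h2, MvPolynomial.coeff_mul, MvPowerSeries.coeff_mul]

/-- The multiplicative set of all `u` in `R[[t]][x]` with leading term `1`: the monomial `1` has
coefficient `1`, and every other monomial of `u` is smaller than `1`. -/
def unitLead (R : Type*) [CommRing R] (o : TLocalOrder m n s) : Submonoid (MixedRing R m n) where
  carrier := {u | coeffAt u 0 = 1 ∧ ∀ p, coeffAt u p ≠ 0 → p = 0 ∨ o.ringGt 0 p}
  one_mem' := by
    refine ⟨by simp [coeffAt_one], fun p hp => Or.inl ?_⟩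
    by_contra h
    simp [coeffAt_one, h] at hp
  mul_mem' := by
    rintro u v ⟨hu, hu'⟩ ⟨hv, hv'⟩
    refine ⟨by rw [coeffAt_zero_mul, hu, hv, one_mul], fun p hp => ?_⟩
    obtain ⟨q, r, rfl, hq, hr⟩ := coeffAt_mul_ne_zero u v p hp
    rcases hu' q hq with rfl | h1
    · rcases hv' r hr with rfl | h2
      · left; simp
      · right; simpa using h2
    · rcases hv' r hr with rfl | h2
      · right; simpa using h1
      · right
        intro i
        have := o.act_gt q _ _ (h2 i)
        simp only [ModMon.act, add_zero] at this
        exact o.trans _ _ _ (h1 i) this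

variable {R : Type*} [CommRing R]

/-- The canonical map from a free module over `R[[t]][x]` to its localization. -/
def toLoc {k : ℕ} (S : Submonoid (MixedRing R m n)) (f : Fin k → MixedRing R m n) :
    Fin k → Localization S :=
  fun j => algebraMap (MixedRing R m n) (Localization S) (f j)

/-- The module generated by the leading terms of the elements of a subset `B` of the localized free
module. The leading term of `f` is that of `u · f` for any `u ∈ S` such that `u · f` lies in the
free module over `R[[t]][x]`. -/
def locLeadModule (o : TLocalOrder m n s) (S : Submonoid (MixedRing R m n))
    (B : Set (Fin s → Localization S)) :
    Submodule (PolyRing R m n) (Fin s → PolyRing R m n) :=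
  Submodule.span (PolyRing R m n)
    {p | ∃ f ∈ B, ∃ u ∈ S, ∃ h : Fin s → MixedRing R m n,
      toLoc S h = algebraMap (MixedRing R m n) (Localization S) u • f ∧ p = leadTerm o h}

/-- `B` is a standard basis of the submodule `M` of the localized free module. -/
def IsStandardBasis (o : TLocalOrder m n s) (S : Submonoid (MixedRing R m n))
    (B : Set (Fin s → Localization S)) (M : Submodule (Localization S) (Fin s → Localization S)) :
    Prop :=
  B.Finite ∧ B ⊆ M ∧ locLeadModule o S B = locLeadModule o S M

end Localization

section Schreyer

theorem TLocalOrder.act_gt_iff {m n s : ℕ} (o : TLocalOrder m n s) (p : Mon m n)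
    (a b : ModMon m n s) : o.gt (a.act p) (b.act p) ↔ o.gt a b := by
  refine ⟨fun h => ?_, o.act_gt p a b⟩
  rcases o.total a b with h1 | h1 | h1
  · exact h1
  · subst h1; exact absurd h (o.irrefl _)
  · exact absurd (o.trans _ _ _ h (o.act_gt p _ _ h1)) (o.irrefl _)

/-- The ordering on the module monomials in `k` components with
`p · ε_i > q · ε_j` if and only if `p · L_i > q · L_j`, or `p · L_i = q · L_j` and `i > j`. -/
def schreyerAux {m n s k : ℕ} (o : TLocalOrder m n s) (L : Fin k → ModMon m n s) :
    TLocalOrder m n k where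
  gt a b := o.gt ((L a.comp).act a.mon) ((L b.comp).act b.mon) ∨
    ((L a.comp).act a.mon = (L b.comp).act b.mon ∧ a.comp > b.comp)
  irrefl a := by
    rintro (h | h)
    · exact o.irrefl _ h
    · exact lt_irrefl _ h.2
  trans a b c := by
    rintro (h | ⟨h, h'⟩) (g | ⟨g, g'⟩)
    · exact Or.inl (o.trans _ _ _ h g)
    · left; rw [← g]; exact h
    · left; rw [h]; exact g
    · exact Or.inr ⟨h.trans g, lt_trans g' h'⟩
  total a b := by
    rcases o.total ((L a.comp).act a.mon) ((L b.comp).act b.mon) with h | h | h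
    · exact Or.inl (Or.inl h)
    · rcases lt_trichotomy a.comp b.comp with h' | h' | h'
      · exact Or.inr (Or.inr (Or.inr ⟨h.symm, h'⟩))
      · right; left
        obtain ⟨p, i⟩ := a
        obtain ⟨q, j⟩ := b
        simp only at h'
        subst h'
        simpa [ModMon.act] using h
      · exact Or.inl (Or.inr ⟨h, h'⟩)
    · exact Or.inr (Or.inr (Or.inl h))
  act_gt p a b := by
    have key : ∀ c : ModMon m n k,
        (L (c.act p).comp).act (c.act p).mon = ((L c.comp).act c.mon).act p := by
      intro c
      simp [ModMon.act, add_assoc]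
    rintro (h | ⟨h, h'⟩)
    · left
      rw [key, key]
      exact o.act_gt p _ _ h
    · right
      rw [key, key, h]
      exact ⟨rfl, h'⟩
  comp_iff p q i j := by
    have key : ∀ i : Fin k, o.gt ((L i).act p) ((L i).act q) ↔
        o.gt ⟨p, (L i).comp⟩ ⟨q, (L i).comp⟩ := by
      intro i
      rw [← o.act_gt_iff (L i).mon ⟨p, (L i).comp⟩]
      simp [ModMon.act, add_comm]
    simp only [gt_iff_lt, lt_irrefl, and_false, or_false]
    rw [key, key]
    exact o.comp_iff _ _ _ _
  tLocal β i hβ := by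
    left
    have h := o.act_gt (L i).mon _ _ (o.tLocal β (L i).comp hβ)
    simpa [ModMon.act, add_comm] using h

variable {R : Type*} [CommRing R] {m n s k : ℕ}

/-- The Schreyer ordering associated to a tuple of nonzero elements. -/
def schreyer (o : TLocalOrder m n s) (g : Fin k → Fin s → MixedRing R m n)
    (hg : ∀ i, g i ≠ 0) : TLocalOrder m n k :=
  schreyerAux o fun i => leadMon o (g i) (hg i)

/-- The substitution homomorphism `ε_i ↦ g_i`. -/
def substHom {B : Type*} [CommRing B] (g : Fin k → Fin s → B) :
    (Fin k → B) →ₗ[B] (Fin s → B) :=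
  Fintype.linearCombination B g

/-- The set of all least common multiples of `lm(g_i)`, `i ∈ J`, where `max J = l` and the
`lm(g_i)` with `i ∈ J` all lie in the same component (otherwise the least common multiple is
`0`). -/
def lcmSet (o : TLocalOrder m n s) (g : Fin k → Fin s → MixedRing R m n)
    (hg : ∀ i, g i ≠ 0) (l : Fin k) : Set (ModMon m n s) :=
  {a | ∃ J : Finset (Fin k), IsGreatest (J : Set (Fin k)) l ∧
    (∀ i ∈ J, (leadMon o (g i) (hg i)).comp = a.comp) ∧
    a.mon = J.sup fun i => (leadMon o (g i) (hg i)).mon}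

open Classical in
/-- The set of all `i ≤ l` such that `lm(g_i)` divides `a`. -/
def divIndices (o : TLocalOrder m n s) (g : Fin k → Fin s → MixedRing R m n)
    (hg : ∀ i, g i ≠ 0) (l : Fin k) (a : ModMon m n s) : Finset (Fin k) :=
  {i | i ≤ l ∧ (leadMon o (g i) (hg i)).Divides a}

/-- The syzygies over `R` of the leading coefficients `lc(g_i)`, `i ∈ J_{l,a}`. A family indexed by
`J_{l,a}` is written as a `k`-tuple that vanishes outside `J_{l,a}`. -/
def coeffSyz (o : TLocalOrder m n s) (g : Fin k → Fin s → MixedRing R m n)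
    (hg : ∀ i, g i ≠ 0) (l : Fin k) (a : ModMon m n s) : Submodule R (Fin k → R) where
  carrier := {c | (∀ i, i ∉ divIndices o g hg l a → c i = 0) ∧
    ∑ i ∈ divIndices o g hg l a, c i * leadCoeff o (g i) (hg i) = 0}
  zero_mem' := by simp
  add_mem' := by
    rintro c d ⟨hc, hc'⟩ ⟨hd, hd'⟩
    refine ⟨fun i hi => by simp [hc i hi, hd i hi], ?_⟩
    simp [add_mul, Finset.sum_add_distrib, hc', hd']
  smul_mem' := by
    rintro x c ⟨hc, hc'⟩
    refine ⟨fun i hi => by simp [hc i hi], ?_⟩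
    simp [mul_assoc, ← Finset.mul_sum, hc']

open Classical in
/-- The set `syz_l` of the elements `∑_{i ∈ J_{l,a}} c_i · (a / lm(g_i)) · ε_i`, where `a` is in
the set of least common multiples and `c` is in the chosen set `SR l a` of generators, with
`c_l ≠ 0`. -/
def leadSyz (o : TLocalOrder m n s) (g : Fin k → Fin s → MixedRing R m n)
    (hg : ∀ i, g i ≠ 0) (SR : Fin k → ModMon m n s → Finset (Fin k → R)) (l : Fin k) :
    Set (Fin k → MixedRing R m n) :=
  {ξ | ∃ a ∈ lcmSet o g hg l, ∃ c ∈ SR l a, c l ≠ 0 ∧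
    ξ = fun i => if i ∈ divIndices o g hg l a then
      mixedTerm (a.mon - (leadMon o (g i) (hg i)).mon) (c i) else 0}

/-- The set of the elements `u · ξ' - ∑_{i ≤ l} q_i · ε_i` for `ξ' ∈ syz_l`, where
`u = u l ξ'` and `q = q l ξ'` belong to the chosen weak division with remainder. -/
def schreyerSyz (o : TLocalOrder m n s) (g : Fin k → Fin s → MixedRing R m n)
    (hg : ∀ i, g i ≠ 0) (SR : Fin k → ModMon m n s → Finset (Fin k → R))
    (u : Fin k → (Fin k → MixedRing R m n) → MixedRing R m n)
    (q : Fin k → (Fin k → MixedRing R m n) → Fin k → MixedRing R m n) (l : Fin k) :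
    Set (Fin k → MixedRing R m n) :=
  {ξ | ∃ ξ' ∈ leadSyz o g hg SR l,
    ξ = u l ξ' • ξ' - ∑ i ∈ Finset.Iic l, q l ξ' i • (Pi.single i 1 : Fin k → MixedRing R m n)}

end Schreyer

end

end MixedStd

open MixedStd

/-!
The proof rests on a dichotomy for the leading monomial of `ξ ∈ A^k` with respect to the Schreyer
ordering, where `A = R[[t]][x]` and `φ` is `substHom g` (`leadTerm_mem_or`). Let `a` be the
largest product of a monomial of `ξ` in some component `i` with `lm(g_i)`. The coefficient of
`φ(ξ)` at `a` is `∑ c_i lc(g_i)`, where `c_i` is the coefficient of `ξ` at `(a / lm(g_i)) ε_i`. If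
it is nonzero, it is the leading coefficient of `φ(ξ)`, so that `lt(φ(ξ))` lies in the module
generated by the `lt(g_i)`. If it vanishes, `c` is a syzygy of leading coefficients, hence a
combination of the chosen generators, and `lt(ξ)` lies in the leading module of the union of the
sets `schreyerSyz … l`, whose elements have leading terms `c_l (a / lm(g_l)) ε_l`
(`exists_mem_schreyerSyz_isLeadMon`). By hypothesis this is the leading module of the given subset
`T`.

For a syzygy `ξ` the second case must hold, which gives the statement on `syz(G)`. For the statement
on `G`, an element of the submodule is, up to a unit of the localization, of the form `φ(ξ)`. As
`φ` vanishes on `T`, `ξ` may be replaced by a weak normal form with respect to `T`, for which the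
second case is impossible; the first case then shows that `lt(φ(ξ))` is in the module generated by
the `lt(g_i)`.

What remains is the existence of weak normal forms (`exists_weakNormalForm`), a version of Mora's
division algorithm. In bounded `x`-degree there are no infinite ascending chains of monomials, and
the quotients of a division are found by a single well-founded recursion on monomials
(`exists_division`). In general, elements carry a bound for their `x`-degree, which plays the role
of the degree of a homogenization in an additional variable. If an intermediate result is not
reducible within its degree, it joins the divisors, and the homogenized leading module
(`homLeadModule`) grows; this can happen only finitely often as `R` is noetherian
(`exists_weakNormalForm_of_divisors`).
-/

namespace MixedStd

noncomputable section

/-! ### Monomial orderings -/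

section Order

variable {m n s : ℕ} (o : TLocalOrder m n s)

/-- The non-strict order `a ≤ b` belonging to a monomial ordering. -/
def TLocalOrder.le (a b : ModMon m n s) : Prop := a = b ∨ o.gt b a

variable {o}

theorem TLocalOrder.le_refl (a : ModMon m n s) : o.le a a := Or.inl rfl

theorem TLocalOrder.le_of_gt {a b : ModMon m n s} (h : o.gt b a) : o.le a b := Or.inr h

theorem TLocalOrder.gt_of_gt_of_le {a b c : ModMon m n s} (h : o.gt c b) (h' : o.le a b) :
    o.gt c a := by
  rcases h' with rfl | h'
  · exact h
  · exact o.trans _ _ _ h h'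

theorem TLocalOrder.gt_of_le_of_gt {a b c : ModMon m n s} (h : o.le b c) (h' : o.gt b a) :
    o.gt c a := by
  rcases h with rfl | h
  · exact h'
  · exact o.trans _ _ _ h h'

theorem TLocalOrder.le_trans {a b c : ModMon m n s} (h : o.le a b) (h' : o.le b c) :
    o.le a c := by
  rcases h with rfl | h
  · exact h'
  · exact Or.inr (o.gt_of_le_of_gt h' h)

theorem TLocalOrder.not_gt_iff {a b : ModMon m n s} : ¬ o.gt a b ↔ o.le a b := by
  constructor
  · intro h
    rcases o.total a b with h' | h' | h'
    · exact absurd h' h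
    · exact Or.inl h'
    · exact Or.inr h'
  · rintro (rfl | h) h'
    · exact o.irrefl _ h'
    · exact o.irrefl _ (o.trans _ _ _ h h')

theorem TLocalOrder.not_le_of_gt {a b : ModMon m n s} (h : o.gt a b) : ¬ o.le a b :=
  fun h' => o.not_gt_iff.2 h' h

theorem TLocalOrder.le_antisymm {a b : ModMon m n s} (h : o.le a b) (h' : o.le b a) : a = b := by
  rcases h with rfl | h
  · rfl
  · exact absurd h' (o.not_le_of_gt h)

theorem TLocalOrder.act_le {a b : ModMon m n s} (p : Mon m n) (h : o.le a b) :
    o.le (a.act p) (b.act p) := by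
  rcases h with rfl | h
  · exact Or.inl rfl
  · exact Or.inr (o.act_gt p _ _ h)

theorem ModMon.act_zero (a : ModMon m n s) : a.act 0 = a := by
  simp [ModMon.act]

theorem ModMon.act_injective (a : ModMon m n s) : Function.Injective fun p => a.act p := by
  intro p q h
  simpa [ModMon.act] using h

theorem ModMon.act_sub {a b : ModMon m n s} (h : a.Divides b) : a.act (b.mon - a.mon) = b := by
  obtain ⟨h1, h2⟩ := h
  ext : 1
  · exact tsub_add_cancel_of_le h2
  · exact h1

theorem ModMon.divides_act (a : ModMon m n s) (p : Mon m n) : a.Divides (a.act p) :=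
  ⟨rfl, le_add_self⟩

theorem ModMon.act_mon_sub (a : ModMon m n s) (p : Mon m n) : (a.act p).mon - a.mon = p :=
  add_tsub_cancel_right p a.mon

theorem gt_act_act_iff (a : ModMon m n s) (p q : Mon m n) :
    o.gt (a.act p) (a.act q) ↔ o.ringGt p q := by
  have h : o.gt (a.act p) (a.act q) ↔ o.gt ⟨p, a.comp⟩ ⟨q, a.comp⟩ := by
    rw [← o.act_gt_iff a.mon ⟨p, a.comp⟩]
    simp [ModMon.act, add_comm]
  rw [h]
  exact ⟨fun h' i => (o.comp_iff p q i a.comp).2 h', fun h' => h' _⟩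

theorem gt_act_iff (a : ModMon m n s) (p : Mon m n) :
    o.gt a (a.act p) ↔ o.ringGt 0 p := by
  rw [← gt_act_act_iff a, ModMon.act_zero]

theorem tPart_add (p q : Mon m n) : (p + q).tPart = p.tPart + q.tPart := by
  ext v; simp [Mon.tPart]

theorem xPart_add (p q : Mon m n) : (p + q).xPart = p.xPart + q.xPart := by
  ext v; simp [Mon.xPart]

/-- The total degree of a monomial in the variables `x`. -/
def Mon.xDeg (p : Mon m n) : ℕ := p.xPart.degree

theorem xDeg_add (p q : Mon m n) : (p + q).xDeg = p.xDeg + q.xDeg := by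
  simp [Mon.xDeg, xPart_add]

/-- Among the monomials of bounded degree in `x` there is no infinite strictly increasing
sequence: only finitely many `x`-parts and components occur, and on the `t`-parts Dickson's lemma
meets the locality of the ordering. The larger monomial is required to have bounded degree, the
smaller one is arbitrary. -/
theorem wellFounded_gt_xDeg_le (o : TLocalOrder m n s) (d : ℕ) :
    WellFounded fun b a : ModMon m n s => o.gt b a ∧ b.mon.xDeg ≤ d := by
  classical
  rw [wellFounded_iff_isEmpty_descending_chain]
  refine ⟨fun ⟨e, he⟩ => ?_⟩
  have hmono : ∀ i j : ℕ, i < j → o.gt (e j) (e i) := by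
    intro i j hij
    induction hij with
    | refl => exact (he i).1
    | step _ ih => exact o.trans _ _ _ (he _).1 ih
  have hfin : {α : Fin n →₀ ℕ | α.degree ≤ d}.Finite := by
    refine (Set.finite_Iic (Finsupp.equivFunOnFinite.symm fun _ => d : Fin n →₀ ℕ)).subset ?_
    intro α hα v
    exact (Finsupp.le_degree v α).trans hα
  have := hfin.to_subtype
  let F : ℕ → Fin s × {α : Fin n →₀ ℕ | α.degree ≤ d} := fun i =>
    ((e (i + 1)).comp, ⟨(e (i + 1)).mon.xPart, (he i).2⟩)
  obtain ⟨y, hy⟩ := Finite.exists_infinite_fiber F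
  have hinf : (F ⁻¹' {y}).Infinite := Set.infinite_coe_iff.1 hy
  let sub := Nat.orderEmbeddingOfSet (F ⁻¹' {y})
  have hsub : ∀ i, F (sub i) = y := fun i => (Nat.orderEmbeddingOfSet_range (F ⁻¹' {y}) ▸
    Set.mem_range_self i : sub i ∈ F ⁻¹' {y})
  obtain ⟨i, j, hij, hle⟩ := wellQuasiOrdered_le (α := Fin m →₀ ℕ)
    (fun i => (e (sub i + 1)).mon.tPart)
  have hF : F (sub i) = F (sub j) := (hsub i).trans (hsub j).symm
  have hcomp : (e (sub i + 1)).comp = (e (sub j + 1)).comp := congrArg Prod.fst hF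
  have hx : (e (sub i + 1)).mon.xPart = (e (sub j + 1)).mon.xPart :=
    congrArg (fun z : Fin s × {α : Fin n →₀ ℕ | α.degree ≤ d} => (z.2 : Fin n →₀ ℕ)) hF
  have hgt := hmono _ _ (Nat.succ_lt_succ (sub.strictMono hij))
  simp only [Nat.succ_eq_add_one] at hgt
  generalize e (sub i + 1) = a at *
  generalize e (sub j + 1) = b at *
  have hb : b = a.act (tMon n (b.mon.tPart - a.mon.tPart)) := by
    ext v
    · rcases v with v | v
      · have := hle v
        simp [ModMon.act, Mon.tPart, tMon] at this ⊢
        omega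
      · have := DFunLike.congr_fun hx v
        simp [ModMon.act, Mon.xPart, tMon] at this ⊢
        exact this.symm
    · exact congrArg Fin.val hcomp.symm
  by_cases h0 : b.mon.tPart - a.mon.tPart = 0
  · have : b = a := by
      rw [hb, h0]
      simp [tMon, ModMon.act]
    subst this
    exact o.irrefl _ hgt
  · have h1 := (gt_act_iff a _).2 fun i => o.tLocal _ i h0
    rw [← hb] at h1
    exact o.irrefl _ (o.trans _ _ _ h1 hgt)

end Order

/-! ### Coefficients -/

section Coeff

variable {R : Type*} [CommRing R] {m n s : ℕ}

theorem coeffAt_sub (f g : MixedRing R m n) (p : Mon m n) :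
    coeffAt (f - g) p = coeffAt f p - coeffAt g p := by
  simp [coeffAt]

theorem coeffAt_zero (p : Mon m n) : coeffAt (0 : MixedRing R m n) p = 0 := by
  simp [coeffAt]

theorem coeffAt_sum {ι : Type*} (t : Finset ι) (f : ι → MixedRing R m n) (p : Mon m n) :
    coeffAt (∑ i ∈ t, f i) p = ∑ i ∈ t, coeffAt (f i) p := by
  simp [coeffAt, MvPolynomial.coeff_sum]

theorem coeffAt_mixedTerm (p q : Mon m n) (c : R) [Decidable (p = q)] :
    coeffAt (mixedTerm p c) q = if p = q then c else 0 := by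
  classical
  have hp : p = q ↔ p.xPart = q.xPart ∧ q.tPart = p.tPart := by
    constructor
    · rintro rfl
      exact ⟨rfl, rfl⟩
    · rintro ⟨h1, h2⟩
      ext v
      rcases v with v | v
      · simpa [Mon.tPart] using (DFunLike.congr_fun h2 v).symm
      · simpa [Mon.xPart] using DFunLike.congr_fun h1 v
  simp only [coeffAt, mixedTerm, MvPolynomial.coeff_monomial, hp]
  by_cases h1 : p.xPart = q.xPart
  · simp [h1, MvPowerSeries.coeff_monomial]
  · simp [h1]

theorem coeffAt_mul (f g : MixedRing R m n) (p : Mon m n) :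
    coeffAt (f * g) p =
      ∑ x ∈ Finset.HasAntidiagonal.antidiagonal p, coeffAt f x.1 * coeffAt g x.2 := by
  classical
  simp only [coeffAt, MvPolynomial.coeff_mul, map_sum, MvPowerSeries.coeff_mul]
  rw [← Finset.sum_product']
  refine Finset.sum_bij'
    (fun z _ => (Finsupp.sumFinsuppEquivProdFinsupp.symm (z.2.1, z.1.1),
      Finsupp.sumFinsuppEquivProdFinsupp.symm (z.2.2, z.1.2)))
    (fun z _ => ((z.1.xPart, z.2.xPart), (z.1.tPart, z.2.tPart))) ?_ ?_ ?_ ?_ ?_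
  · rintro ⟨⟨a, b⟩, c, d⟩ h
    simp only [Finset.mem_product, Finset.HasAntidiagonal.mem_antidiagonal] at h ⊢
    ext v
    rcases v with v | v
    · simpa [Mon.tPart] using DFunLike.congr_fun h.2 v
    · simpa [Mon.xPart] using DFunLike.congr_fun h.1 v
  · rintro ⟨a, b⟩ h
    simp only [Finset.mem_product, Finset.HasAntidiagonal.mem_antidiagonal] at h ⊢
    subst h
    exact ⟨(xPart_add a b).symm, (tPart_add a b).symm⟩
  · rintro ⟨⟨a, b⟩, c, d⟩ -
    simp [Mon.xPart, Mon.tPart]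
  · rintro ⟨a, b⟩ -
    simp [Mon.xPart, Mon.tPart]
  · rintro ⟨⟨a, b⟩, c, d⟩ -
    simp [Mon.xPart, Mon.tPart]

theorem modCoeff_sub (f g : Fin s → MixedRing R m n) (a : ModMon m n s) :
    modCoeff (f - g) a = modCoeff f a - modCoeff g a := coeffAt_sub _ _ _

theorem modCoeff_zero (a : ModMon m n s) : modCoeff (0 : Fin s → MixedRing R m n) a = 0 :=
  coeffAt_zero _

theorem modCoeff_sum {ι : Type*} (t : Finset ι) (f : ι → Fin s → MixedRing R m n)
    (a : ModMon m n s) : modCoeff (∑ i ∈ t, f i) a = ∑ i ∈ t, modCoeff (f i) a := by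
  simp only [modCoeff, Finset.sum_apply, coeffAt_sum]

theorem modCoeff_smul (w : MixedRing R m n) (f : Fin s → MixedRing R m n) (a : ModMon m n s) :
    modCoeff (w • f) a =
      ∑ x ∈ Finset.HasAntidiagonal.antidiagonal a.mon, coeffAt w x.1 * modCoeff f ⟨x.2, a.comp⟩ :=
  coeffAt_mul _ _ _

theorem exists_of_modCoeff_smul_ne_zero {w : MixedRing R m n} {f : Fin s → MixedRing R m n}
    {a : ModMon m n s} (h : modCoeff (w • f) a ≠ 0) :
    ∃ p b, b.act p = a ∧ coeffAt w p ≠ 0 ∧ modCoeff f b ≠ 0 := by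
  obtain ⟨p, r, hpr, hp, hr⟩ := coeffAt_mul_ne_zero _ _ _ h
  refine ⟨p, ⟨r, a.comp⟩, ?_, hp, hr⟩
  ext : 1
  · exact hpr
  · rfl

/-- An element of `R[[t]][x]` with prescribed coefficients, vanishing in large `x`-degree. -/
theorem exists_coeffAt_eq (F : Mon m n → R) (d : ℕ) (hF : ∀ p, F p ≠ 0 → p.xDeg ≤ d) :
    ∃ f : MixedRing R m n, ∀ p, coeffAt f p = F p := by
  classical
  let G : (Fin n →₀ ℕ) → MvPowerSeries (Fin m) R := fun α β =>
    F (Finsupp.sumFinsuppEquivProdFinsupp.symm (β, α))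
  refine ⟨∑ α ∈ Finset.Iic (Finsupp.equivFunOnFinite.symm fun _ => d : Fin n →₀ ℕ),
    MvPolynomial.monomial α (G α), fun p => ?_⟩
  have hp : Finsupp.sumFinsuppEquivProdFinsupp.symm (p.tPart, p.xPart) = p := by
    simp [Mon.tPart, Mon.xPart]
  rw [coeffAt, MvPolynomial.coeff_sum]
  simp only [MvPolynomial.coeff_monomial, Finset.sum_ite_eq', Finset.mem_Iic]
  split_ifs with h
  · change F _ = F p
    rw [hp]
  · rw [map_zero]
    by_contra h0
    exact h fun v => (Finsupp.le_degree v p.xPart).trans (hF p (Ne.symm h0))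

/-- `d` bounds the degree in `x` of all monomials of `f`. -/
def XDegLE (f : Fin s → MixedRing R m n) (d : ℕ) : Prop :=
  ∀ a, modCoeff f a ≠ 0 → a.mon.xDeg ≤ d

theorem XDegLE.mono {f : Fin s → MixedRing R m n} {d e : ℕ} (h : XDegLE f d) (hde : d ≤ e) :
    XDegLE f e := fun a ha => (h a ha).trans hde

theorem exists_xDegLE (f : Fin s → MixedRing R m n) : ∃ d, XDegLE f d := by
  refine ⟨Finset.univ.sup fun i => (f i).support.sup Finsupp.degree, fun a ha => ?_⟩
  refine le_trans ?_ (Finset.le_sup (f := fun i => (f i).support.sup Finsupp.degree)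
    (Finset.mem_univ a.comp))
  refine Finset.le_sup (f := Finsupp.degree) (MvPolynomial.mem_support_iff.2 fun h => ha ?_)
  rw [modCoeff, coeffAt, h, map_zero]

end Coeff

/-! ### Leading monomials -/

section Lead

variable {R : Type*} [CommRing R] {m n s : ℕ} {o : TLocalOrder m n s}

theorem IsLeadMon.le {f : Fin s → MixedRing R m n} {a b : ModMon m n s} (h : IsLeadMon o f a)
    (hb : modCoeff f b ≠ 0) : o.le b a := h.2 b hb

theorem IsLeadMon.ne_zero {f : Fin s → MixedRing R m n} {a : ModMon m n s}
    (h : IsLeadMon o f a) : f ≠ 0 := by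
  rintro rfl
  exact h.1 (modCoeff_zero a)

theorem IsLeadMon.unique {f : Fin s → MixedRing R m n} {a b : ModMon m n s}
    (h : IsLeadMon o f a) (h' : IsLeadMon o f b) : a = b :=
  o.le_antisymm (h'.le h.1) (h.le h'.1)

theorem isLeadMon_leadMon (f : Fin s → MixedRing R m n) (hf : f ≠ 0) :
    IsLeadMon o f (leadMon o f hf) := (exists_isLeadMon o f hf).choose_spec

theorem IsLeadMon.leadTerm_eq {f : Fin s → MixedRing R m n} {a : ModMon m n s}
    (h : IsLeadMon o f a) :
    leadTerm o f = Pi.single a.comp (MvPolynomial.monomial a.mon (modCoeff f a)) := by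
  have := h.ne_zero
  rw [leadTerm, dif_pos this, leadCoeff, (isLeadMon_leadMon f this).unique h]

theorem leadTerm_zero : leadTerm o (0 : Fin s → MixedRing R m n) = 0 := by
  simp [leadTerm]

theorem exists_isRingLeadMon (hs : 0 < s) (w : MixedRing R m n) (hw : w ≠ 0) :
    ∃ p, IsRingLeadMon o w p := by
  have hne : (Pi.single ⟨0, hs⟩ w : Fin s → MixedRing R m n) ≠ 0 := by simpa using hw
  obtain ⟨a, ha, ha'⟩ := exists_isLeadMon o _ hne
  have hc : a.comp = ⟨0, hs⟩ := by
    by_contra hc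
    apply ha
    rw [modCoeff, Pi.single_eq_of_ne hc, coeffAt_zero]
  obtain ⟨p, c⟩ := a
  simp only at hc
  subst hc
  refine ⟨p, by simpa [modCoeff] using ha, fun q hq => ?_⟩
  rcases ha' ⟨q, ⟨0, hs⟩⟩ (by simpa [modCoeff] using hq) with h | h
  · left
    simpa using h
  · right
    intro i
    exact (o.comp_iff p q i _).2 h

/-- The product of a ring element with an element of leading monomial `L`, seen from a bound `a`
for the products of the monomials of `w` with `L`: only the leading term contributes at `a`. -/
theorem modCoeff_smul_of_forall_le {w : MixedRing R m n} {f : Fin s → MixedRing R m n}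
    {L a : ModMon m n s} (hf : IsLeadMon o f L)
    (hw : ∀ p, coeffAt w p ≠ 0 → o.le (L.act p) a) [Decidable (L.Divides a)] :
    modCoeff (w • f) a =
      if L.Divides a then coeffAt w (a.mon - L.mon) * modCoeff f L else 0 := by
  have key : ∀ x ∈ Finset.HasAntidiagonal.antidiagonal a.mon, x.2 ≠ L.mon ∨ a.comp ≠ L.comp →
      coeffAt w x.1 * modCoeff f ⟨x.2, a.comp⟩ = 0 := by
    rintro ⟨p, r⟩ hx hne
    rw [Finset.HasAntidiagonal.mem_antidiagonal] at hx
    simp only at hx hne ⊢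
    by_contra h
    have h1 := hw p (left_ne_zero_of_mul h)
    have ha : (⟨r, a.comp⟩ : ModMon m n s).act p = a := by
      ext : 1
      · exact hx
      · rfl
    rcases hf.2 _ (right_ne_zero_of_mul h) with h2 | h2
    · subst h2
      simp at hne
    · have := o.act_gt p _ _ h2
      rw [ha] at this
      exact o.not_le_of_gt this h1
  rw [modCoeff_smul]
  split_ifs with hd
  · rw [Finset.sum_eq_single (a.mon - L.mon, L.mon)]
    · rw [← hd.1]
    · rintro ⟨p, r⟩ hx hne
      refine key _ hx (Or.inl fun h => hne ?_)
      rw [Finset.HasAntidiagonal.mem_antidiagonal] at hx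
      simp only at hx h
      rw [← hx, ← h, add_tsub_cancel_right]
    · intro h
      exact absurd (Finset.HasAntidiagonal.mem_antidiagonal.2 (tsub_add_cancel_of_le hd.2)) h
  · refine Finset.sum_eq_zero fun x hx => key x hx ?_
    by_contra! h
    refine hd ⟨h.2.symm, ?_⟩
    rw [Finset.HasAntidiagonal.mem_antidiagonal] at hx
    rw [← h.1, ← hx]
    exact le_add_self

theorem exists_le_of_modCoeff_smul_ne_zero {w : MixedRing R m n} {f : Fin s → MixedRing R m n}
    {L a : ModMon m n s} (hf : IsLeadMon o f L) (h : modCoeff (w • f) a ≠ 0) :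
    ∃ p, coeffAt w p ≠ 0 ∧ o.le a (L.act p) := by
  obtain ⟨p, b, rfl, hp, hb⟩ := exists_of_modCoeff_smul_ne_zero h
  exact ⟨p, hp, o.act_le p (hf.le hb)⟩

theorem le_one_of_mem_unitLead {u : MixedRing R m n} (hu : u ∈ unitLead R o) {p : Mon m n}
    (hp : coeffAt u p ≠ 0) (a : ModMon m n s) : o.le (a.act p) a := by
  rcases hu.2 p hp with rfl | h
  · exact Or.inl a.act_zero
  · exact Or.inr ((gt_act_iff a p).2 h)

theorem IsLeadMon.smul_mem_unitLead {u : MixedRing R m n} (hu : u ∈ unitLead R o)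
    {f : Fin s → MixedRing R m n} {a : ModMon m n s} (h : IsLeadMon o f a) :
    IsLeadMon o (u • f) a ∧ modCoeff (u • f) a = modCoeff f a := by
  classical
  have hc : modCoeff (u • f) a = modCoeff f a := by
    rw [modCoeff_smul_of_forall_le h fun p hp => le_one_of_mem_unitLead hu hp a,
      if_pos ⟨rfl, _root_.le_refl _⟩, tsub_self, hu.1, one_mul]
  refine ⟨⟨hc ▸ h.1, fun b hb => ?_⟩, hc⟩
  obtain ⟨p, hp, hle⟩ := exists_le_of_modCoeff_smul_ne_zero h hb
  exact o.le_trans hle (le_one_of_mem_unitLead hu hp a)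

theorem smul_ne_zero_of_mem_unitLead {u : MixedRing R m n} (hu : u ∈ unitLead R o)
    {f : Fin s → MixedRing R m n} (hf : f ≠ 0) : u • f ≠ 0 :=
  ((isLeadMon_leadMon f hf).smul_mem_unitLead (o := o) hu).1.ne_zero

theorem leadTerm_smul {u : MixedRing R m n} (hu : u ∈ unitLead R o)
    (f : Fin s → MixedRing R m n) : leadTerm o (u • f) = leadTerm o f := by
  by_cases hf : f = 0
  · rw [hf, smul_zero]
  · have h := isLeadMon_leadMon (o := o) f hf
    rw [h.leadTerm_eq, (h.smul_mem_unitLead hu).1.leadTerm_eq, (h.smul_mem_unitLead hu).2]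

theorem unitLead_le_nonZeroDivisors (hs : 0 < s) :
    unitLead R o ≤ nonZeroDivisors (MixedRing R m n) := by
  intro u hu
  rw [mem_nonZeroDivisors_iff_right]
  intro w hw
  by_contra h
  have hne : (Pi.single ⟨0, hs⟩ w : Fin s → MixedRing R m n) ≠ 0 := by simpa using h
  apply smul_ne_zero_of_mem_unitLead hu hne
  rw [← Pi.single_smul, smul_eq_mul, mul_comm, hw, Pi.single_zero]

/-- A linear combination of elements with leading monomials `L i`, seen from a bound `a` for the
products of the monomials of the coefficients with the `L i`. -/
theorem modCoeff_sum_smul_of_forall_le {ι : Type*} [Fintype ι] {h : ι → Fin s → MixedRing R m n}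
    {L : ι → ModMon m n s} (hL : ∀ i, IsLeadMon o (h i) (L i)) {w : ι → MixedRing R m n}
    {a : ModMon m n s} (hw : ∀ i p, coeffAt (w i) p ≠ 0 → o.le ((L i).act p) a)
    [∀ i, Decidable ((L i).Divides a)] :
    modCoeff (∑ i, w i • h i) a = ∑ i, if (L i).Divides a then
      coeffAt (w i) (a.mon - (L i).mon) * modCoeff (h i) (L i) else 0 := by
  rw [modCoeff_sum]
  exact Finset.sum_congr rfl fun i _ => modCoeff_smul_of_forall_le (hL i) (hw i)

theorem exists_le_of_modCoeff_sum_smul_ne_zero {ι : Type*} [Fintype ι]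
    {h : ι → Fin s → MixedRing R m n} {L : ι → ModMon m n s}
    (hL : ∀ i, IsLeadMon o (h i) (L i)) {w : ι → MixedRing R m n} {a : ModMon m n s}
    (ha : modCoeff (∑ i, w i • h i) a ≠ 0) :
    ∃ i p, coeffAt (w i) p ≠ 0 ∧ o.le a ((L i).act p) := by
  rw [modCoeff_sum] at ha
  obtain ⟨i, -, hi⟩ := Finset.exists_ne_zero_of_sum_ne_zero ha
  obtain ⟨p, hp, hle⟩ := exists_le_of_modCoeff_smul_ne_zero (hL i) hi
  exact ⟨i, p, hp, hle⟩

end Lead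

/-! ### Division in bounded `x`-degree -/

section Division

variable {R : Type*} [CommRing R] {m n s : ℕ} {o : TLocalOrder m n s} {ι : Type*}

/-- The ideal of all coefficients `c` such that `c · a` is cancelled by leading terms of multiples
`p · h_i`, where `dg i` bounds the `x`-degree of `h_i` and the multiples stay in `x`-degree at
most `d`. The element `h_i` has leading monomial `L i`. -/
def redIdeal (h : ι → Fin s → MixedRing R m n) (L : ι → ModMon m n s) (dg : ι → ℕ) (d : ℕ)
    (a : ModMon m n s) : Ideal R :=
  Ideal.span ((fun i => modCoeff (h i) (L i)) '' {i | ∃ p, (L i).act p = a ∧ p.xDeg + dg i ≤ d})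

variable [Fintype ι] {h : ι → Fin s → MixedRing R m n} {L : ι → ModMon m n s} {dg : ι → ℕ}

theorem sum_mem_redIdeal {d : ℕ} {a : ModMon m n s} {c : ι → R}
    (hc : ∀ i, c i ≠ 0 → ∃ p, (L i).act p = a ∧ p.xDeg + dg i ≤ d) :
    ∑ i, c i * modCoeff (h i) (L i) ∈ redIdeal h L dg d a := by
  refine Ideal.sum_mem _ fun i _ => ?_
  by_cases h0 : c i = 0
  · rw [h0, zero_mul]
    exact Ideal.zero_mem _
  · exact Ideal.mul_mem_left _ _ (Ideal.subset_span ⟨i, hc i h0, rfl⟩)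

theorem exists_sum_eq_of_mem_redIdeal {d : ℕ} {a : ModMon m n s} {r : R}
    (hr : r ∈ redIdeal h L dg d a) :
    ∃ c : ι → R, (∀ i, c i ≠ 0 → ∃ p, (L i).act p = a ∧ p.xDeg + dg i ≤ d) ∧
      ∑ i, c i * modCoeff (h i) (L i) = r := by
  refine Submodule.span_induction ?_ ?_ ?_ ?_ hr
  · classical
    rintro _ ⟨i, hi, rfl⟩
    refine ⟨Pi.single i 1, fun j hj => ?_, ?_⟩
    · rcases eq_or_ne j i with rfl | hne
      · exact hi
      · exact absurd (Pi.single_eq_of_ne hne _) hj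
    · rw [Finset.sum_eq_single i]
      · simp
      · intro j _ hne
        simp [hne]
      · simp
  · exact ⟨0, by simp, by simp⟩
  · rintro _ _ - - ⟨c, hc, rfl⟩ ⟨c', hc', rfl⟩
    refine ⟨c + c', fun i hi => ?_, by simp [add_mul, Finset.sum_add_distrib]⟩
    by_cases h0 : c i = 0
    · exact hc' i fun h1 => hi (by simp [h0, h1])
    · exact hc i h0
  · rintro x _ - ⟨c, hc, rfl⟩
    refine ⟨x • c, fun i hi => hc i fun h1 => hi (by simp [h1]), ?_⟩
    simp [Finset.mul_sum, mul_assoc]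

/-- The part of the coefficient of `q_i · h_i` at `a` that comes from monomials `p` of `q_i` with
`p · L i = a` is the only one not determined by larger monomials. -/
theorem modCoeff_smul_eq_sum_add {f : Fin s → MixedRing R m n} {M : ModMon m n s}
    (hf : IsLeadMon o f M) {w : MixedRing R m n} {C : ModMon m n s → R}
    (hw : ∀ p, coeffAt w p = C (M.act p)) {a : ModMon m n s} (hC : C a ≠ 0 → M.Divides a)
    [∀ p, Decidable (o.gt (M.act p) a)] :
    modCoeff (w • f) a = (∑ x ∈ Finset.HasAntidiagonal.antidiagonal a.mon,
      if o.gt (M.act x.1) a then C (M.act x.1) * modCoeff f ⟨x.2, a.comp⟩ else 0) +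
      C a * modCoeff f M := by
  classical
  have hsplit : ∀ x : Mon m n × Mon m n,
      coeffAt w x.1 * modCoeff f ⟨x.2, a.comp⟩ =
        (if o.gt (M.act x.1) a then C (M.act x.1) * modCoeff f ⟨x.2, a.comp⟩ else 0) +
        (if o.gt (M.act x.1) a then 0 else C (M.act x.1) * modCoeff f ⟨x.2, a.comp⟩) := by
    intro x
    rw [hw]
    split_ifs <;> simp
  rw [modCoeff_smul, Finset.sum_congr rfl fun x _ => hsplit x, Finset.sum_add_distrib]
  congr 1
  have key : ∀ x ∈ Finset.HasAntidiagonal.antidiagonal a.mon,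
      x ≠ (a.mon - M.mon, M.mon) ∨ ¬ M.Divides a →
      (if o.gt (M.act x.1) a then 0 else C (M.act x.1) * modCoeff f ⟨x.2, a.comp⟩) = 0 := by
    rintro ⟨p, r⟩ hx hne
    rw [Finset.HasAntidiagonal.mem_antidiagonal] at hx
    simp only at hx ⊢
    split_ifs with hgt
    · rfl
    by_contra h0
    have ha : (⟨r, a.comp⟩ : ModMon m n s).act p = a := by
      ext : 1
      · exact hx
      · rfl
    rcases hf.2 _ (right_ne_zero_of_mul h0) with h2 | h2
    · rw [h2] at ha
      rcases hne with hne | hne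
      · apply hne
        rw [← ha, ModMon.act_mon_sub, ← h2]
      · exact hne (ha ▸ ModMon.divides_act _ _)
    · have := o.act_gt p _ _ h2
      rw [ha] at this
      exact hgt this
  by_cases hd : M.Divides a
  · rw [Finset.sum_eq_single (a.mon - M.mon, M.mon) (fun x hx hne => key x hx (Or.inl hne))]
    · simp only [ModMon.act_sub hd, if_neg (o.irrefl a), ← hd.1]
    · intro h'
      exact absurd (Finset.HasAntidiagonal.mem_antidiagonal.2 (tsub_add_cancel_of_le hd.2)) h'
  · rw [Finset.sum_eq_zero fun x hx => key x hx (Or.inr hd)]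
    by_cases h0 : C a = 0
    · rw [h0, zero_mul]
    · exact absurd (hC h0) hd

/-- Division with remainder in bounded `x`-degree. The multiples of the divisors needed at the
monomial `a` only depend on those used at larger monomials, so all coefficients of the quotients
are obtained by one well-founded recursion; no limit process is involved. -/
theorem exists_division (hL : ∀ i, IsLeadMon o (h i) (L i)) (hdg : ∀ i, XDegLE (h i) (dg i))
    (f : Fin s → MixedRing R m n) (d : ℕ) :
    ∃ q : ι → MixedRing R m n,
      (∀ i p, coeffAt (q i) p ≠ 0 → p.xDeg + dg i ≤ d ∧
        ∃ b, modCoeff f b ≠ 0 ∧ o.le ((L i).act p) b) ∧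
      ∀ a, modCoeff (f - ∑ i, q i • h i) a ∈ redIdeal h L dg d a →
        modCoeff (f - ∑ i, q i • h i) a = 0 := by
  classical
  have key : ∀ (a : ModMon m n s) (r : R), ∃ c : ι → R,
      (∀ i, c i ≠ 0 → r ≠ 0 ∧ ∃ p, (L i).act p = a ∧ p.xDeg + dg i ≤ d) ∧
      (r ∈ redIdeal h L dg d a → ∑ i, c i * modCoeff (h i) (L i) = r) := by
    intro a r
    by_cases hr : r = 0
    · exact ⟨0, by simp, by simp [hr]⟩
    by_cases hm : r ∈ redIdeal h L dg d a
    · obtain ⟨c, hc, hc'⟩ := exists_sum_eq_of_mem_redIdeal hm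
      exact ⟨c, fun i hi => ⟨hr, hc i hi⟩, fun _ => hc'⟩
    · exact ⟨0, by simp, fun h' => absurd h' hm⟩
  choose step hstep hstep' using key
  -- what is left at `a` after subtracting the multiples that belong to larger monomials
  let res : ModMon m n s → (ModMon m n s → ι → R) → R := fun a C =>
    modCoeff f a - ∑ i, ∑ x ∈ Finset.HasAntidiagonal.antidiagonal a.mon,
      if o.gt ((L i).act x.1) a then
        C ((L i).act x.1) i * modCoeff (h i) ⟨x.2, a.comp⟩ else 0
  have hwf := wellFounded_gt_xDeg_le o d
  obtain ⟨C, hC⟩ : ∃ C : ModMon m n s → ι → R, ∀ a, C a = step a (res a fun b =>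
      if o.gt b a ∧ b.mon.xDeg ≤ d then C b else 0) :=
    ⟨hwf.fix fun a rec => step a (res a fun b =>
      if hb : o.gt b a ∧ b.mon.xDeg ≤ d then rec b hb else 0), fun a => by
        rw [hwf.fix_eq]
        simp only [dite_eq_ite]⟩
  have hsupp : ∀ a i, C a i ≠ 0 → ∃ p, (L i).act p = a ∧ p.xDeg + dg i ≤ d := by
    intro a i hi
    rw [hC] at hi
    exact (hstep _ _ _ hi).2
  have hdeg : ∀ a i, C a i ≠ 0 → a.mon.xDeg ≤ d := by
    intro a i hi
    obtain ⟨p, rfl, hp⟩ := hsupp a i hi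
    have := hdg i _ (hL i).1
    simp only [ModMon.act, xDeg_add]
    omega
  -- coefficients belonging to monomials of too large degree vanish
  have hC' : ∀ a, C a = step a (res a C) := by
    intro a
    rw [hC]
    congr 1
    simp only [res]
    congr 1
    refine Finset.sum_congr rfl fun i _ => Finset.sum_congr rfl fun x _ => ?_
    by_cases h1 : o.gt ((L i).act x.1) a
    · by_cases h2 : ((L i).act x.1).mon.xDeg ≤ d
      · rw [if_pos h1, if_pos h1, if_pos ⟨h1, h2⟩]
      · have : C ((L i).act x.1) i = 0 := by
          by_contra h3
          exact h2 (hdeg _ _ h3)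
        rw [if_pos h1, if_pos h1, if_neg fun h3 => h2 h3.2, this, Pi.zero_apply]
    · rw [if_neg h1, if_neg h1]
  have hle : ∀ a, ∀ i, C a i ≠ 0 → ∃ b, modCoeff f b ≠ 0 ∧ o.le a b := by
    intro a
    induction a using hwf.induction with
    | _ a ih =>
      intro i hi
      by_cases hfa : modCoeff f a = 0
      · rw [hC'] at hi
        have hres := (hstep _ _ _ hi).1
        simp only [res, hfa, zero_sub] at hres
        obtain ⟨j, -, hj⟩ := Finset.exists_ne_zero_of_sum_ne_zero (neg_ne_zero.1 hres)
        obtain ⟨x, -, hx⟩ := Finset.exists_ne_zero_of_sum_ne_zero hj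
        have hgt : o.gt ((L j).act x.1) a := by
          by_contra h0
          simp [h0] at hx
        rw [if_pos hgt] at hx
        have hx' := left_ne_zero_of_mul hx
        obtain ⟨b, hb, hb'⟩ := ih _ ⟨hgt, hdeg _ _ hx'⟩ j hx'
        exact ⟨b, hb, o.le_trans (o.le_of_gt hgt) hb'⟩
      · exact ⟨a, hfa, o.le_refl a⟩
  have hsupp' : ∀ i p, C ((L i).act p) i ≠ 0 → p.xDeg + dg i ≤ d := by
    intro i p hp
    obtain ⟨p', hp', hd⟩ := hsupp _ _ hp
    rwa [← (L i).act_injective hp']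
  choose q hq using fun i => exists_coeffAt_eq (fun p => C ((L i).act p) i) d
    fun p hp => le_of_add_le_left (hsupp' i p hp)
  refine ⟨q, fun i p hp => ?_, fun a ha => ?_⟩
  · rw [hq] at hp
    exact ⟨hsupp' i p hp, hle _ i hp⟩
  have hρ : modCoeff (f - ∑ i, q i • h i) a =
      res a C - ∑ i, C a i * modCoeff (h i) (L i) := by
    have : ∀ i, C a i ≠ 0 → (L i).Divides a := by
      intro i hi
      obtain ⟨p, rfl, -⟩ := hsupp a i hi
      exact ModMon.divides_act _ _
    rw [modCoeff_sub, modCoeff_sum, Finset.sum_congr rfl fun i _ =>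
      modCoeff_smul_eq_sum_add (C := fun b => C b i) (hL i) (hq i) (this i),
      Finset.sum_add_distrib, ← sub_sub]
  have hmem : res a C ∈ redIdeal h L dg d a := by
    rw [hρ] at ha
    simpa using Ideal.add_mem _ ha (sum_mem_redIdeal (h := h) (hsupp a))
  rw [hρ, sub_eq_zero, hC' a, hstep' _ _ hmem]

/-- If the leading term of `f` is reducible, the remainder has only smaller monomials. -/
theorem gt_of_modCoeff_sub_ne_zero (hL : ∀ i, IsLeadMon o (h i) (L i))
    {f : Fin s → MixedRing R m n} {d : ℕ} {q : ι → MixedRing R m n}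
    (hq : ∀ i p, coeffAt (q i) p ≠ 0 → p.xDeg + dg i ≤ d ∧
      ∃ b, modCoeff f b ≠ 0 ∧ o.le ((L i).act p) b)
    (hred : ∀ a, modCoeff (f - ∑ i, q i • h i) a ∈ redIdeal h L dg d a →
      modCoeff (f - ∑ i, q i • h i) a = 0)
    {a : ModMon m n s} (ha : IsLeadMon o f a) (hm : modCoeff f a ∈ redIdeal h L dg d a)
    {b : ModMon m n s} (hb : modCoeff (f - ∑ i, q i • h i) b ≠ 0) : o.gt a b := by
  classical
  have hqa : ∀ i p, coeffAt (q i) p ≠ 0 → o.le ((L i).act p) a := by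
    intro i p hp
    obtain ⟨-, c, hc, hle⟩ := hq i p hp
    exact o.le_trans hle (ha.le hc)
  have hle : o.le b a := by
    by_cases hfb : modCoeff f b = 0
    · rw [modCoeff_sub, hfb, zero_sub, neg_ne_zero] at hb
      obtain ⟨i, p, hp, hle⟩ := exists_le_of_modCoeff_sum_smul_ne_zero hL hb
      exact o.le_trans hle (hqa i p hp)
    · exact ha.le hfb
  rcases hle with rfl | hgt
  · refine absurd (hred b ?_) hb
    rw [modCoeff_sub, modCoeff_sum_smul_of_forall_le hL hqa]
    refine Ideal.sub_mem _ hm ?_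
    have : ∀ i, (if (L i).Divides b then coeffAt (q i) (b.mon - (L i).mon) *
        modCoeff (h i) (L i) else 0) =
        (if (L i).Divides b then coeffAt (q i) (b.mon - (L i).mon) else 0) *
          modCoeff (h i) (L i) := by
      intro i
      split_ifs <;> simp
    rw [Finset.sum_congr rfl fun i _ => this i]
    refine sum_mem_redIdeal fun i hi => ?_
    by_cases hd : (L i).Divides b
    · rw [if_pos hd] at hi
      exact ⟨_, ModMon.act_sub hd, (hq i _ hi).1⟩
    · simp [hd] at hi
  · exact hgt

theorem xDegLE_sub_sum (hdg : ∀ i, XDegLE (h i) (dg i)) {f : Fin s → MixedRing R m n} {d : ℕ}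
    (hf : XDegLE f d) {q : ι → MixedRing R m n}
    (hq : ∀ i p, coeffAt (q i) p ≠ 0 → p.xDeg + dg i ≤ d) :
    XDegLE (f - ∑ i, q i • h i) d := by
  intro a ha
  by_cases hfa : modCoeff f a = 0
  · rw [modCoeff_sub, hfa, zero_sub, neg_ne_zero, modCoeff_sum] at ha
    obtain ⟨i, -, hi⟩ := Finset.exists_ne_zero_of_sum_ne_zero ha
    obtain ⟨p, b, rfl, hp, hb⟩ := exists_of_modCoeff_smul_ne_zero hi
    have h1 := hq i p hp
    have h2 := hdg i b hb
    simp only [ModMon.act, xDeg_add]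
    omega
  · exact hf a hfa

end Division

/-! ### Modules generated by terms -/

section Terms

variable {R : Type*} [CommRing R] {s : ℕ} {σ : Type*}

/-- The submodule of a free module over a polynomial ring generated by the terms
`c · X^e · ε_j` for `(j, e, c) ∈ Y`. -/
def termSpan (Y : Set (Fin s × (σ →₀ ℕ) × R)) :
    Submodule (MvPolynomial σ R) (Fin s → MvPolynomial σ R) :=
  Submodule.span (MvPolynomial σ R)
    ((fun y => Pi.single y.1 (MvPolynomial.monomial y.2.1 y.2.2)) '' Y)

theorem coeff_mem_of_mem_termSpan {Y : Set (Fin s × (σ →₀ ℕ) × R)}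
    {P : Fin s → MvPolynomial σ R} (hP : P ∈ termSpan Y) (j : Fin s) (a : σ →₀ ℕ) :
    MvPolynomial.coeff a (P j) ∈ Ideal.span {c | ∃ e, (j, e, c) ∈ Y ∧ e ≤ a} := by
  classical
  induction hP using Submodule.span_induction generalizing a with
  | mem x hx =>
    obtain ⟨⟨i, e, c⟩, hy, rfl⟩ := hx
    rcases eq_or_ne j i with rfl | hne
    · simp only [Pi.single_eq_same, MvPolynomial.coeff_monomial]
      split_ifs with h
      · exact Ideal.subset_span ⟨e, hy, h.le⟩
      · exact Ideal.zero_mem _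
    · simp [hne]
  | zero => simp
  | add x y _ _ hx hy =>
    rw [Pi.add_apply, MvPolynomial.coeff_add]
    exact Ideal.add_mem _ (hx a) (hy a)
  | smul w x _ hx =>
    rw [Pi.smul_apply, smul_eq_mul, MvPolynomial.coeff_mul]
    refine Ideal.sum_mem _ fun z hz => Ideal.mul_mem_left _ _ ?_
    rw [Finset.HasAntidiagonal.mem_antidiagonal] at hz
    refine Ideal.span_mono ?_ (hx z.2)
    rintro c ⟨e, he, hle⟩
    exact ⟨e, he, hle.trans (hz ▸ le_add_self)⟩

theorem single_monomial_mem_termSpan_iff {Y : Set (Fin s × (σ →₀ ℕ) × R)} {j : Fin s}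
    {a : σ →₀ ℕ} {x : R} :
    Pi.single j (MvPolynomial.monomial a x) ∈ termSpan Y ↔
      x ∈ Ideal.span {c | ∃ e, (j, e, c) ∈ Y ∧ e ≤ a} := by
  classical
  constructor
  · intro h
    simpa using coeff_mem_of_mem_termSpan h j a
  · intro h
    induction h using Submodule.span_induction with
    | mem x hx =>
      obtain ⟨e, hy, hle⟩ := hx
      have := Submodule.smul_mem (termSpan Y) (MvPolynomial.monomial (a - e) (1 : R))
        (Submodule.subset_span ⟨_, hy, rfl⟩)
      rw [← Pi.single_smul, smul_eq_mul, MvPolynomial.monomial_mul, one_mul,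
        tsub_add_cancel_of_le hle] at this
      exact this
    | zero => simp
    | add x y _ _ hx hy =>
      rw [map_add, Pi.single_add]
      exact Submodule.add_mem _ hx hy
    | smul w x _ hx =>
      have := Submodule.smul_mem (termSpan Y) (MvPolynomial.C w) hx
      rwa [← Pi.single_smul, smul_eq_mul, MvPolynomial.C_mul_monomial] at this

variable {m n : ℕ} {o : TLocalOrder m n s}

theorem leadModule_eq_termSpan (B : Set (Fin s → MixedRing R m n)) :
    leadModule o B = termSpan {y | ∃ f ∈ B, ∃ a, IsLeadMon o f a ∧
      y = (a.comp, a.mon, modCoeff f a)} := by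
  apply le_antisymm
  · refine Submodule.span_le.2 ?_
    rintro _ ⟨f, hf, rfl⟩
    by_cases h0 : f = 0
    · rw [h0, leadTerm_zero]
      exact Submodule.zero_mem _
    · have h := isLeadMon_leadMon (o := o) f h0
      rw [h.leadTerm_eq]
      exact Submodule.subset_span ⟨_, ⟨f, hf, _, h, rfl⟩, rfl⟩
  · refine Submodule.span_le.2 ?_
    rintro _ ⟨_, ⟨f, hf, a, ha, rfl⟩, rfl⟩
    exact Submodule.subset_span ⟨f, hf, ha.leadTerm_eq⟩

/-- A term lies in the leading module of `B` if and only if its coefficient lies in the ideal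
generated by those leading coefficients whose leading monomial divides it. -/
theorem single_monomial_mem_leadModule_iff {B : Set (Fin s → MixedRing R m n)}
    {a : ModMon m n s} {x : R} :
    Pi.single a.comp (MvPolynomial.monomial a.mon x) ∈ leadModule o B ↔
      x ∈ Ideal.span {c | ∃ f ∈ B, ∃ b, IsLeadMon o f b ∧ b.Divides a ∧ modCoeff f b = c} := by
  rw [leadModule_eq_termSpan, single_monomial_mem_termSpan_iff]
  have : {c | ∃ e, (a.comp, e, c) ∈ {y : Fin s × Mon m n × R | ∃ f ∈ B, ∃ a, IsLeadMon o f a ∧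
      y = (a.comp, a.mon, modCoeff f a)} ∧ e ≤ a.mon} =
      {c | ∃ f ∈ B, ∃ b, IsLeadMon o f b ∧ b.Divides a ∧ modCoeff f b = c} := by
    ext c
    constructor
    · rintro ⟨e, ⟨f, hf, b, hb, h⟩, hle⟩
      simp only [Prod.mk.injEq] at h
      obtain ⟨h1, rfl, rfl⟩ := h
      exact ⟨f, hf, b, hb, ⟨h1.symm, hle⟩, rfl⟩
    · rintro ⟨f, hf, b, hb, hd, rfl⟩
      exact ⟨b.mon, ⟨f, hf, b, hb, by rw [hd.1]⟩, hd.2⟩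
  rw [this]

end Terms

/-! ### Weak normal forms -/

section NormalForm

variable {R : Type*} [CommRing R] {m n s : ℕ} {o : TLocalOrder m n s}

/-- The module generated by the leading terms `x_0^(d - deg_x lm(h)) · lt(h)` of the
homogenizations, with respect to `x`, of the elements `h` with `(h, d) ∈ D`, where `d` is a bound
for the `x`-degree of `h`. The variable `x_0` is indexed by `none`. -/
def homLeadModule (o : TLocalOrder m n s) (D : Set ((Fin s → MixedRing R m n) × ℕ)) :
    Submodule (MvPolynomial (Option (Fin m ⊕ Fin n)) R)
      (Fin s → MvPolynomial (Option (Fin m ⊕ Fin n)) R) :=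
  termSpan {y | ∃ x ∈ D, ∃ a, IsLeadMon o x.1 a ∧
    y = (a.comp, a.mon.optionElim (x.2 - a.mon.xDeg), modCoeff x.1 a)}

theorem homLeadModule_mono {D E : Set ((Fin s → MixedRing R m n) × ℕ)} (h : D ⊆ E) :
    homLeadModule o D ≤ homLeadModule o E := by
  refine Submodule.span_mono (Set.image_mono ?_)
  rintro y ⟨x, hx, hy⟩
  exact ⟨x, h hx, hy⟩

/-- The term `c · a` of an element of `x`-degree at most `d` is reducible in `x`-degree at most `d`
if its homogenization to degree `d` lies in the homogenized leading module. -/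
theorem mem_redIdeal_of_mem_homLeadModule {D : Set ((Fin s → MixedRing R m n) × ℕ)}
    (hD : ∀ x ∈ D, XDegLE x.1 x.2) {L : D → ModMon m n s}
    (hL : ∀ i : D, IsLeadMon o i.1.1 (L i)) {a : ModMon m n s} {d : ℕ} (had : a.mon.xDeg ≤ d)
    {c : R} (hc : Pi.single a.comp (MvPolynomial.monomial
      (a.mon.optionElim (d - a.mon.xDeg)) c) ∈ homLeadModule o D) :
    c ∈ redIdeal (fun i : D => i.1.1) L (fun i => i.1.2) d a := by
  rw [homLeadModule, single_monomial_mem_termSpan_iff] at hc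
  refine Ideal.span_mono ?_ hc
  rintro _ ⟨e, ⟨x, hx, b, hb, h⟩, hle⟩
  simp only [Prod.mk.injEq] at h
  obtain ⟨h1, rfl, rfl⟩ := h
  obtain rfl : b = L ⟨x, hx⟩ := hb.unique (hL ⟨x, hx⟩)
  have hdiv : (L ⟨x, hx⟩).Divides a := by
    refine ⟨h1.symm, fun v => ?_⟩
    simpa using hle (some v)
  have h0 : x.2 - (L ⟨x, hx⟩).mon.xDeg ≤ d - a.mon.xDeg := by
    simpa using hle none
  have hx2 := hD x hx _ hb.1
  refine ⟨⟨x, hx⟩, ⟨a.mon - (L ⟨x, hx⟩).mon, ModMon.act_sub hdiv, ?_⟩, rfl⟩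
  have := xDeg_add (a.mon - (L ⟨x, hx⟩).mon) (L ⟨x, hx⟩).mon
  rw [tsub_add_cancel_of_le hdiv.2] at this
  simp only
  omega

theorem mem_homLeadModule_insert {D : Set ((Fin s → MixedRing R m n) × ℕ)}
    {f : Fin s → MixedRing R m n} {d : ℕ} {a : ModMon m n s} (ha : IsLeadMon o f a) :
    Pi.single a.comp (MvPolynomial.monomial (a.mon.optionElim (d - a.mon.xDeg)) (modCoeff f a)) ∈
      homLeadModule o (insert (f, d) D) :=
  Submodule.subset_span ⟨_, ⟨(f, d), Set.mem_insert _ _, a, ha, rfl⟩, rfl⟩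

theorem sub_mem_unitLead (hs : 0 < s) {u w : MixedRing R m n} (hu : u ∈ unitLead R o)
    (hw : ∀ p, coeffAt w p ≠ 0 → o.ringGt 0 p) : u - w ∈ unitLead R o := by
  have h0 : coeffAt w 0 = 0 := by
    by_contra h
    exact o.irrefl _ (hw 0 h ⟨0, hs⟩)
  refine ⟨by rw [coeffAt_sub, hu.1, h0, sub_zero], fun p hp => ?_⟩
  by_cases hwp : coeffAt w p = 0
  · rw [coeffAt_sub, hwp, sub_zero] at hp
    exact hu.2 p hp
  · exact Or.inr (hw p hwp)

/-- One reduction step of Mora's algorithm. The divisors in `D` are elements of the submodule `N`,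
or earlier reductions of `f`, whose leading monomials exceed all monomials of the current reduction
`f'`. In the latter case the quotients have only monomials smaller than `1`, so that the factor in
front of `f` keeps the leading term `1`. -/
theorem exists_reduction {N : Submodule (MixedRing R m n) (Fin s → MixedRing R m n)}
    {f : Fin s → MixedRing R m n} {D : Set ((Fin s → MixedRing R m n) × ℕ)} (hfin : D.Finite)
    (hD : ∀ x ∈ D, XDegLE x.1 x.2) {L : D → ModMon m n s}
    (hL : ∀ i : D, IsLeadMon o i.1.1 (L i)) {f' : Fin s → MixedRing R m n}
    (hDN : ∀ x ∈ D, x.1 ∈ N ∨ ((∃ v ∈ unitLead R o, v • f - x.1 ∈ N) ∧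
      ∀ a, IsLeadMon o x.1 a → ∀ b, modCoeff f' b ≠ 0 → o.gt a b))
    (hf' : ∃ u ∈ unitLead R o, u • f - f' ∈ N) {d : ℕ} (hd : XDegLE f' d)
    {a : ModMon m n s} (ha : IsLeadMon o f' a)
    (hred : modCoeff f' a ∈ redIdeal (fun i : D => i.1.1) L (fun i => i.1.2) d a) :
    ∃ f'' : Fin s → MixedRing R m n, (∃ u ∈ unitLead R o, u • f - f'' ∈ N) ∧ XDegLE f'' d ∧
      (∀ b, modCoeff f'' b ≠ 0 → o.gt a b) ∧
      ∀ b, modCoeff f'' b ∈ redIdeal (fun i : D => i.1.1) L (fun i => i.1.2) d b →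
        modCoeff f'' b = 0 := by
  have := hfin.fintype
  obtain ⟨q, hq, hq'⟩ := exists_division (h := fun i : D => i.1.1) hL
    (fun i => hD i.1 i.2) f' d
  refine ⟨f' - ∑ i : D, q i • i.1.1, ?_,
    xDegLE_sub_sum (h := fun i : D => i.1.1) (fun i => hD i.1 i.2) hd fun i p hp => (hq i p hp).1,
    fun b hb => gt_of_modCoeff_sub_ne_zero (h := fun i : D => i.1.1) hL hq hq' ha hred hb, hq'⟩
  have hv : ∀ i : D, ∃ v, v • f - i.1.1 ∈ N ∧
      (v ≠ 0 → v ∈ unitLead R o ∧ ∀ b, modCoeff f' b ≠ 0 → o.gt (L i) b) := by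
    intro i
    rcases hDN i.1 i.2 with h | ⟨⟨v, hv, hv'⟩, hgt⟩
    · exact ⟨0, by simpa using h, fun h => absurd rfl h⟩
    · exact ⟨v, hv', fun _ => ⟨hv, hgt _ (hL i)⟩⟩
  choose v hv hv' using hv
  obtain ⟨u, hu, hu'⟩ := hf'
  refine ⟨u - ∑ i, q i * v i, sub_mem_unitLead a.comp.pos hu fun p hp => ?_, ?_⟩
  · rw [coeffAt_sum] at hp
    obtain ⟨i, -, hi⟩ := Finset.exists_ne_zero_of_sum_ne_zero hp
    obtain ⟨p, r, rfl, hp, hr⟩ := coeffAt_mul_ne_zero _ _ _ hi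
    have hvi : v i ≠ 0 := by
      intro h0
      rw [h0, coeffAt_zero] at hr
      exact hr rfl
    obtain ⟨hS, hgt⟩ := hv' i hvi
    obtain ⟨-, b, hb, hle⟩ := hq i p hp
    rw [← gt_act_iff (L i)]
    refine o.gt_of_gt_of_le (o.gt_of_gt_of_le (hgt b hb) hle) ?_
    have := le_one_of_mem_unitLead hS hr ((L i).act p)
    have h2 : ((L i).act p).act r = (L i).act (p + r) := by
      simp [ModMon.act, add_comm, add_left_comm]
    rwa [h2] at this
  · have : (u - ∑ i, q i * v i) • f - (f' - ∑ i : D, q i • i.1.1) =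
        (u • f - f') - ∑ i : D, q i • (v i • f - i.1.1) := by
      funext j
      simp only [Pi.sub_apply, Pi.smul_apply, Finset.sum_apply, smul_eq_mul, sub_mul,
        Finset.sum_mul, mul_sub, Finset.sum_sub_distrib, mul_assoc]
      ring
    rw [this]
    exact N.sub_mem hu' (N.sum_mem fun i _ => N.smul_mem _ (hv i))

/-- The recursion in Mora's algorithm: an irreducible intermediate result is added to the set of
divisors, which strictly enlarges the homogenized leading module. -/
theorem exists_weakNormalForm_of_divisors [IsNoetherianRing R]
    {T : Set (Fin s → MixedRing R m n)} {f : Fin s → MixedRing R m n}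
    (M : Submodule (MvPolynomial (Option (Fin m ⊕ Fin n)) R)
      (Fin s → MvPolynomial (Option (Fin m ⊕ Fin n)) R)) :
    ∀ D : Set ((Fin s → MixedRing R m n) × ℕ), homLeadModule o D = M → D.Finite →
      (∀ x ∈ D, x.1 ≠ 0 ∧ XDegLE x.1 x.2) → (∀ t ∈ T, t ≠ 0 → ∃ d, (t, d) ∈ D) →
      ∀ (f' : Fin s → MixedRing R m n) (d : ℕ), XDegLE f' d →
      (∃ u ∈ unitLead R o, u • f - f' ∈ Submodule.span (MixedRing R m n) T) →
      (∀ x ∈ D, x.1 ∈ Submodule.span (MixedRing R m n) T ∨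
        ((∃ v ∈ unitLead R o, v • f - x.1 ∈ Submodule.span (MixedRing R m n) T) ∧
          ∀ a, IsLeadMon o x.1 a → ∀ b, modCoeff f' b ≠ 0 → o.gt a b)) →
      ∃ u ∈ unitLead R o, ∃ r, u • f - r ∈ Submodule.span (MixedRing R m n) T ∧
        (r ≠ 0 → leadTerm o r ∉ leadModule o T) := by
  induction M using WellFoundedGT.induction with
  | ind M ih =>
  intro D hM hfin hD hT
  set N := Submodule.span (MixedRing R m n) T
  let L : D → ModMon m n s := fun i => leadMon o i.1.1 (hD i.1 i.2).1
  have hL : ∀ i : D, IsLeadMon o i.1.1 (L i) := fun i => isLeadMon_leadMon _ _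
  have hDdeg : ∀ x ∈ D, XDegLE x.1 x.2 := fun x hx => (hD x hx).2
  -- the case that the homogenized leading term of `f'` is not reducible by `D`
  have main : ∀ (f' : Fin s → MixedRing R m n) (d : ℕ), XDegLE f' d →
      (∃ u ∈ unitLead R o, u • f - f' ∈ N) →
      (∀ x ∈ D, x.1 ∈ N ∨ ((∃ v ∈ unitLead R o, v • f - x.1 ∈ N) ∧
          ∀ a, IsLeadMon o x.1 a → ∀ b, modCoeff f' b ≠ 0 → o.gt a b)) →
      (∀ a, IsLeadMon o f' a → Pi.single a.comp (MvPolynomial.monomial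
        (a.mon.optionElim (d - a.mon.xDeg)) (modCoeff f' a)) ∉ homLeadModule o D) →
      ∃ u ∈ unitLead R o, ∃ r, u • f - r ∈ N ∧ (r ≠ 0 → leadTerm o r ∉ leadModule o T) := by
    intro f' d hd hu hDN hirr
    by_cases hend : f' ≠ 0 → leadTerm o f' ∉ leadModule o T
    · obtain ⟨u, hu, hu'⟩ := hu
      exact ⟨u, hu, f', hu', hend⟩
    push Not at hend
    obtain ⟨hne, hlt⟩ := hend
    have ha := isLeadMon_leadMon (o := o) f' hne
    set a := leadMon o f' hne
    rw [ha.leadTerm_eq, single_monomial_mem_leadModule_iff] at hlt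
    -- in sufficiently large degree the leading term becomes reducible
    obtain ⟨e, he⟩ : ∃ e, ∀ x ∈ D, x.2 ≤ e := by
      obtain ⟨e, he⟩ := (hfin.image Prod.snd).bddAbove
      exact ⟨e, fun x hx => he ⟨x, hx, rfl⟩⟩
    have hred : modCoeff f' a ∈ redIdeal (fun i : D => i.1.1) L (fun i => i.1.2)
        (d + a.mon.xDeg + e) a := by
      refine Ideal.span_mono ?_ hlt
      rintro _ ⟨t, ht, b, hb, hdiv, rfl⟩
      obtain ⟨dt, hdt⟩ := hT t ht hb.ne_zero
      obtain rfl : b = L ⟨_, hdt⟩ := hb.unique (hL ⟨_, hdt⟩)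
      refine ⟨⟨_, hdt⟩, ⟨_, ModMon.act_sub hdiv, ?_⟩, rfl⟩
      have h1 := he _ hdt
      have h2 := xDeg_add (a.mon - (L ⟨_, hdt⟩).mon) (L ⟨_, hdt⟩).mon
      rw [tsub_add_cancel_of_le hdiv.2] at h2
      simp only at h1 ⊢
      omega
    obtain ⟨f'', hu'', hd'', hgt, -⟩ := exists_reduction hfin hDdeg hL hDN hu
      (hd.mono (show d ≤ d + a.mon.xDeg + e by omega)) ha hred
    have hlt' : M < homLeadModule o (insert (f', d) D) := by
      rw [← hM]
      refine lt_of_le_of_ne (homLeadModule_mono (Set.subset_insert _ _)) fun heq => ?_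
      apply hirr a ha
      rw [heq]
      exact mem_homLeadModule_insert ha
    refine ih _ hlt' _ rfl (hfin.insert _) ?_ ?_ f'' _ hd'' hu'' ?_
    · rintro x (rfl | hx)
      · exact ⟨hne, hd⟩
      · exact hD x hx
    · intro t ht h0
      obtain ⟨dt, hdt⟩ := hT t ht h0
      exact ⟨dt, Set.mem_insert_of_mem _ hdt⟩
    · rintro x (rfl | hx)
      · refine Or.inr ⟨hu, fun b hb c hc => ?_⟩
        rw [hb.unique ha]
        exact hgt c hc
      · refine (hDN x hx).imp_right fun h => ⟨h.1, fun b hb c hc => ?_⟩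
        exact o.trans _ _ _ (h.2 b hb a ha.1) (hgt c hc)
  intro f' d hd hu hDN
  by_cases hcase : ∃ a, IsLeadMon o f' a ∧ Pi.single a.comp (MvPolynomial.monomial
      (a.mon.optionElim (d - a.mon.xDeg)) (modCoeff f' a)) ∈ homLeadModule o D
  · -- after one division in degree `d`, no further reduction by `D` in degree `d` is possible
    obtain ⟨a, ha, hmem⟩ := hcase
    obtain ⟨f'', hu'', hd'', hgt, hirr⟩ := exists_reduction hfin hDdeg hL hDN hu hd ha
      (mem_redIdeal_of_mem_homLeadModule hDdeg hL (hd a ha.1) hmem)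
    refine main f'' d hd'' hu'' (fun x hx => ?_) fun b hb hmem' => hb.1 (hirr b ?_)
    · refine (hDN x hx).imp_right fun h => ⟨h.1, fun b hb c hc => ?_⟩
      exact o.trans _ _ _ (h.2 b hb a ha.1) (hgt c hc)
    · exact mem_redIdeal_of_mem_homLeadModule hDdeg hL (hd'' b hb.1) hmem'
  · push Not at hcase
    exact main f' d hd hu hDN hcase

/-- Weak normal forms exist with respect to finite sets. -/
theorem exists_weakNormalForm [IsNoetherianRing R] {T : Set (Fin s → MixedRing R m n)}
    (hT : T.Finite) (f : Fin s → MixedRing R m n) :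
    ∃ u ∈ unitLead R o, ∃ r, u • f - r ∈ Submodule.span (MixedRing R m n) T ∧
      (r ≠ 0 → leadTerm o r ∉ leadModule o T) := by
  choose deg hdeg using exists_xDegLE (R := R) (m := m) (n := n) (s := s)
  refine exists_weakNormalForm_of_divisors _ ((fun t => (t, deg t)) '' (T \ {0})) rfl
    (hT.sdiff.image _) ?_ ?_ f (deg f) (hdeg f) ⟨1, one_mem _, by simp⟩ ?_
  · rintro _ ⟨t, ht, rfl⟩
    exact ⟨ht.2, hdeg t⟩
  · exact fun t ht h0 => ⟨deg t, t, ⟨ht, h0⟩, rfl⟩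
  · rintro _ ⟨t, ht, rfl⟩
    exact Or.inl (Submodule.subset_span ht.1)

end NormalForm

/-! ### Leading terms of syzygies -/

section Syzygies

variable {R : Type*} [CommRing R] {m n s k : ℕ} {o : TLocalOrder m n s}
  {g : Fin k → Fin s → MixedRing R m n} {hg : ∀ i, g i ≠ 0}

theorem substHom_eq_sum {B : Type*} [CommRing B] (g : Fin k → Fin s → B) (ξ : Fin k → B) :
    substHom g ξ = ∑ i, ξ i • g i :=
  Fintype.linearCombination_apply B g ξ

theorem le_of_schreyer_le {a b : ModMon m n k} (h : (schreyer o g hg).le a b) :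
    o.le ((leadMon o (g a.comp) (hg a.comp)).act a.mon)
      ((leadMon o (g b.comp) (hg b.comp)).act b.mon) := by
  rcases h with rfl | h | h
  · exact Or.inl rfl
  · exact Or.inr h
  · exact Or.inl h.1.symm

theorem comp_le_of_schreyer_le {a b : ModMon m n k} (h : (schreyer o g hg).le a b)
    (heq : (leadMon o (g a.comp) (hg a.comp)).act a.mon =
      (leadMon o (g b.comp) (hg b.comp)).act b.mon) : a.comp ≤ b.comp := by
  rcases h with rfl | h | h
  · exact le_rfl
  · exact absurd (heq ▸ h) (o.irrefl _)
  · exact h.2.le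

/-- The Schreyer ordering restricts to the original ordering on the monomials of the ring. For
`k = 0` it has no component to restrict to, and the claim fails. -/
theorem unitLead_schreyer (hk : 0 < k) : unitLead R (schreyer o g hg) = unitLead R o := by
  have key : ∀ p, (schreyer o g hg).ringGt 0 p ↔ o.ringGt 0 p := by
    intro p
    rw [← gt_act_iff (⟨0, ⟨0, hk⟩⟩ : ModMon m n k),
      ← gt_act_act_iff (leadMon o (g ⟨0, hk⟩) (hg ⟨0, hk⟩))]
    simp [schreyer, schreyerAux, ModMon.act]
  ext u
  change (_ ∧ ∀ p, _ → p = 0 ∨ (schreyer o g hg).ringGt 0 p) ↔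
    (_ ∧ ∀ p, _ → p = 0 ∨ o.ringGt 0 p)
  simp only [key]

theorem mem_divIndices {l i : Fin k} {a : ModMon m n s} :
    i ∈ divIndices o g hg l a ↔ i ≤ l ∧ (leadMon o (g i) (hg i)).Divides a := by
  simp [divIndices]

theorem divides_of_mem_lcmSet {l : Fin k} {a : ModMon m n s} (ha : a ∈ lcmSet o g hg l) :
    (leadMon o (g l) (hg l)).Divides a := by
  obtain ⟨J, hJ, hc, hm⟩ := ha
  exact ⟨hc l hJ.1, hm ▸ Finset.le_sup (f := fun i => (leadMon o (g i) (hg i)).mon) hJ.1⟩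

/-- Passing from `ξ'` to `u · ξ' - ∑ q_i · ε_i` does not change the leading term
`c_l · (a / lm(g_l)) · ε_l`: all products of monomials of `q_i` with `lm(g_i)` are smaller than `a`,
because the terms of `φ(ξ')` at `a` cancel. -/
theorem exists_mem_schreyerSyz_isLeadMon {SR : Fin k → ModMon m n s → Finset (Fin k → R)}
    (hSR : ∀ l, ∀ a ∈ lcmSet o g hg l,
      Submodule.span R (SR l a : Set (Fin k → R)) = coeffSyz o g hg l a)
    {u : Fin k → (Fin k → MixedRing R m n) → MixedRing R m n}
    {q : Fin k → (Fin k → MixedRing R m n) → Fin k → MixedRing R m n}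
    {r : Fin k → (Fin k → MixedRing R m n) → Fin s → MixedRing R m n}
    (hdiv : ∀ l, ∀ ξ' ∈ leadSyz o g hg SR l,
      u l ξ' ∈ unitLead R o ∧
        IsDivision o g (Finset.Iic l) (u l ξ' • substHom g ξ') (q l ξ') (r l ξ'))
    {l : Fin k} {a : ModMon m n s} (ha : a ∈ lcmSet o g hg l) {c : Fin k → R} (hc : c ∈ SR l a)
    (hcl : c l ≠ 0) :
    ∃ ζ ∈ schreyerSyz o g hg SR u q l,
      IsLeadMon (schreyer o g hg) ζ ⟨a.mon - (leadMon o (g l) (hg l)).mon, l⟩ ∧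
      modCoeff ζ ⟨a.mon - (leadMon o (g l) (hg l)).mon, l⟩ = c l := by
  classical
  set L : Fin k → ModMon m n s := fun i => leadMon o (g i) (hg i) with hLdef
  have hL : ∀ i, IsLeadMon o (g i) (L i) := fun i => isLeadMon_leadMon _ _
  have hla : (L l).Divides a := divides_of_mem_lcmSet ha
  have hcs : c ∈ coeffSyz o g hg l a := hSR l a ha ▸ Submodule.subset_span hc
  set ξ' : Fin k → MixedRing R m n := fun i => if i ∈ divIndices o g hg l a then
      mixedTerm (a.mon - (leadMon o (g i) (hg i)).mon) (c i) else 0 with hξdef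
  have hξ' : ξ' ∈ leadSyz o g hg SR l := by
    refine ⟨a, ha, c, hc, hcl, ?_⟩
    rw [hξdef]
  obtain ⟨hu, hq⟩ := hdiv l ξ' hξ'
  have hcoeff : ∀ p i, coeffAt (ξ' i) p =
      if i ∈ divIndices o g hg l a ∧ a.mon - (L i).mon = p then c i else 0 := by
    intro p i
    by_cases hi : i ∈ divIndices o g hg l a
    · simp only [hξdef, if_pos hi, coeffAt_mixedTerm, hi, true_and, hLdef]
    · simp only [hξdef, if_neg hi, coeffAt_zero, hi, false_and, if_false]
  have hmon : ∀ p i, coeffAt (ξ' i) p ≠ 0 → i ≤ l ∧ (L i).act p = a := by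
    intro p i hp
    rw [hcoeff] at hp
    obtain ⟨⟨hi, rfl⟩, -⟩ := ite_ne_right_iff.1 hp
    rw [mem_divIndices] at hi
    exact ⟨hi.1, ModMon.act_sub hi.2⟩
  have hlead : IsLeadMon (schreyer o g hg) ξ' ⟨a.mon - (L l).mon, l⟩ ∧
      modCoeff ξ' ⟨a.mon - (L l).mon, l⟩ = c l := by
    have h1 : modCoeff ξ' ⟨a.mon - (L l).mon, l⟩ = c l := by
      rw [modCoeff, hcoeff, if_pos ⟨mem_divIndices.2 ⟨le_rfl, hla⟩, rfl⟩]
    refine ⟨⟨h1 ▸ hcl, fun b hb => ?_⟩, h1⟩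
    obtain ⟨p, i⟩ := b
    obtain ⟨hil, hp⟩ := hmon p i hb
    have hp' : (L i).act p = (L l).act (a.mon - (L l).mon) := hp.trans (ModMon.act_sub hla).symm
    rcases hil.lt_or_eq with hil | rfl
    · exact Or.inr (Or.inr ⟨hp'.symm, hil⟩)
    · exact Or.inl (by rw [(L i).act_injective hp'])
  -- the terms of `φ(ξ')` at `a` cancel
  have hzero : modCoeff (substHom g ξ') a = 0 := by
    rw [substHom_eq_sum, modCoeff_sum_smul_of_forall_le hL
      fun i p hp => Or.inl (hmon p i hp).2]
    refine Eq.trans ?_ hcs.2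
    refine (Finset.sum_subset (Finset.subset_univ _) fun i _ hi => ?_).symm.trans
      (Finset.sum_congr rfl fun i hi => ?_)
    · have : coeffAt (ξ' i) (a.mon - (L i).mon) = 0 := by
        rw [hcoeff, if_neg fun h => hi h.1]
      rw [this, zero_mul, ite_self]
    · rw [if_pos (mem_divIndices.1 hi).2, hcoeff, if_pos ⟨hi, rfl⟩]
      rfl
  have hlt : ∀ b, modCoeff (u l ξ' • substHom g ξ') b ≠ 0 → o.gt a b := by
    intro b hb
    obtain ⟨p, b, rfl, hp, hb⟩ := exists_of_modCoeff_smul_ne_zero hb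
    refine o.gt_of_gt_of_le ?_ (le_one_of_mem_unitLead hu hp b)
    have hne : b ≠ a := by
      rintro rfl
      exact hb hzero
    rw [substHom_eq_sum] at hb
    obtain ⟨i, p', hp', hle⟩ := exists_le_of_modCoeff_sum_smul_ne_zero hL hb
    rw [(hmon p' i hp').2] at hle
    exact hle.resolve_left hne
  have hqlt : ∀ i ≤ l, ∀ p, coeffAt (q l ξ' i) p ≠ 0 → o.gt a ((L i).act p) := by
    intro i hi p hp
    have hne : q l ξ' i ≠ 0 := by
      intro h0
      rw [h0, coeffAt_zero] at hp
      exact hp rfl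
    obtain ⟨P, hP⟩ := exists_isRingLeadMon (o := o) a.comp.pos _ hne
    obtain ⟨b, hb, hPb⟩ := hq.id1 i (Finset.mem_Iic.2 hi) P (L i) hP (hL i)
    refine o.gt_of_gt_of_le (hlt b hb.1) (o.le_trans ?_ (o.not_gt_iff.1 hPb))
    rcases hP.2 p hp with rfl | h
    · exact o.le_refl _
    · exact o.le_of_gt ((gt_act_act_iff _ _ _).2 h)
  have hsum : ∀ b : ModMon m n k, modCoeff (∑ i ∈ Finset.Iic l,
      q l ξ' i • (Pi.single i 1 : Fin k → MixedRing R m n)) b =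
      if b.comp ≤ l then coeffAt (q l ξ' b.comp) b.mon else 0 := by
    intro b
    have : (∑ i ∈ Finset.Iic l, q l ξ' i • (Pi.single i 1 : Fin k → MixedRing R m n)) b.comp =
        if b.comp ≤ l then q l ξ' b.comp else 0 := by
      simp [Finset.sum_apply, Pi.single_apply]
    rw [modCoeff, this]
    split_ifs
    · rfl
    · exact coeffAt_zero _
  obtain ⟨hlead', hlc'⟩ := hlead.1.smul_mem_unitLead
    (u := u l ξ') (by rwa [unitLead_schreyer l.pos])
  have hql : coeffAt (q l ξ' l) (a.mon - (L l).mon) = 0 := by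
    by_contra h
    have := hqlt l le_rfl _ h
    rw [ModMon.act_sub hla] at this
    exact o.irrefl _ this
  have hval : modCoeff (u l ξ' • ξ' - ∑ i ∈ Finset.Iic l,
      q l ξ' i • (Pi.single i 1 : Fin k → MixedRing R m n)) ⟨a.mon - (L l).mon, l⟩ = c l := by
    rw [modCoeff_sub, hsum, hlc', hlead.2]
    simp only [le_refl, if_true, hql, sub_zero]
  refine ⟨_, ⟨ξ', hξ', rfl⟩, ⟨?_, fun b hb => ?_⟩, hval⟩
  · rw [hval]
    exact hcl
  · by_cases h0 : modCoeff (u l ξ' • ξ') b = 0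
    · rw [modCoeff_sub, h0, zero_sub, neg_ne_zero, hsum] at hb
      obtain ⟨hbl, hb⟩ := ite_ne_right_iff.1 hb
      refine Or.inr (Or.inl ?_)
      have := hqlt _ hbl _ hb
      rwa [← ModMon.act_sub hla] at this
    · exact hlead'.2 b h0

/-- The dichotomy behind the theorem. Let `a` be the largest of the products of the monomials of
`ξ` in component `i` with `lm(g_i)`. If the terms of `φ(ξ)` at `a` do not cancel, they form its
leading term. If they cancel, the coefficients of `ξ` involved form a syzygy of leading
coefficients, and the leading term of `ξ` is a combination of those of the chosen syzygies. -/
theorem leadTerm_mem_or {SR : Fin k → ModMon m n s → Finset (Fin k → R)}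
    (hSR : ∀ l, ∀ a ∈ lcmSet o g hg l,
      Submodule.span R (SR l a : Set (Fin k → R)) = coeffSyz o g hg l a)
    {u : Fin k → (Fin k → MixedRing R m n) → MixedRing R m n}
    {q : Fin k → (Fin k → MixedRing R m n) → Fin k → MixedRing R m n}
    {r : Fin k → (Fin k → MixedRing R m n) → Fin s → MixedRing R m n}
    (hdiv : ∀ l, ∀ ξ' ∈ leadSyz o g hg SR l,
      u l ξ' ∈ unitLead R o ∧
        IsDivision o g (Finset.Iic l) (u l ξ' • substHom g ξ') (q l ξ') (r l ξ'))
    {ξ : Fin k → MixedRing R m n} (hξ : ξ ≠ 0) :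
    leadTerm (schreyer o g hg) ξ ∈
        leadModule (schreyer o g hg) (⋃ l, schreyerSyz o g hg SR u q l) ∨
      (substHom g ξ ≠ 0 ∧ leadTerm o (substHom g ξ) ∈ leadModule o (Set.range g)) := by
  classical
  set L : Fin k → ModMon m n s := fun i => leadMon o (g i) (hg i) with hLdef
  have hL : ∀ i, IsLeadMon o (g i) (L i) := fun i => isLeadMon_leadMon _ _
  obtain ⟨⟨p, l⟩, hb⟩ := exists_isLeadMon (schreyer o g hg) ξ hξ
  set a' := (L l).act p with ha'
  have hbound : ∀ i p', coeffAt (ξ i) p' ≠ 0 → o.le ((L i).act p') a' := fun i p' hp' =>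
    le_of_schreyer_le (hb.le (b := ⟨p', i⟩) hp')
  let c : Fin k → R := fun i =>
    if (L i).Divides a' then coeffAt (ξ i) (a'.mon - (L i).mon) else 0
  have hval : modCoeff (substHom g ξ) a' = ∑ i, c i * modCoeff (g i) (L i) := by
    rw [substHom_eq_sum, modCoeff_sum_smul_of_forall_le hL hbound]
    refine Finset.sum_congr rfl fun i _ => ?_
    simp only [c]
    split_ifs <;> simp
  have hcdiv : ∀ i, c i ≠ 0 → (L i).Divides a' := fun i hi => (ite_ne_right_iff.1 hi).1
  by_cases hx : modCoeff (substHom g ξ) a' = 0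
  · left
    rw [hx] at hval
    let J : Finset (Fin k) := {i | c i ≠ 0}
    have hJ : ∀ i, i ∈ J ↔ c i ≠ 0 := fun i => by simp [J]
    have hcl : c l = modCoeff ξ ⟨p, l⟩ := by
      simp only [c]
      rw [if_pos (ModMon.divides_act _ _), ModMon.act_mon_sub]
      rfl
    have hmax : ∀ i ∈ J, i ≤ l := by
      intro i hi
      rw [hJ] at hi
      have hd := hcdiv i hi
      simp only [c, if_pos hd] at hi
      exact comp_le_of_schreyer_le (hb.le (b := ⟨a'.mon - (L i).mon, i⟩) hi)
        (ModMon.act_sub hd)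
    let a : ModMon m n s := ⟨J.sup fun i => (L i).mon, a'.comp⟩
    have ha : a ∈ lcmSet o g hg l :=
      ⟨J, ⟨by simpa [hJ, hcl] using hb.1, fun i hi => hmax i hi⟩,
        fun i hi => (hcdiv i ((hJ i).1 hi)).1, rfl⟩
    have haa' : a.mon ≤ a'.mon := Finset.sup_le fun i hi => (hcdiv i ((hJ i).1 hi)).2
    have hJdiv : ∀ i, c i ≠ 0 → i ∈ divIndices o g hg l a := by
      intro i hi
      rw [← hJ] at hi
      exact mem_divIndices.2 ⟨hmax i hi, (hcdiv i ((hJ i).1 hi)).1,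
        Finset.le_sup (f := fun i => (L i).mon) hi⟩
    have hc : c ∈ coeffSyz o g hg l a := by
      refine ⟨fun i hi => by_contra fun h => hi (hJdiv i h), ?_⟩
      rw [hval]
      refine Finset.sum_subset (Finset.subset_univ _) fun i _ hi => ?_
      have : c i = 0 := by_contra fun h => hi (hJdiv i h)
      rw [this, zero_mul]
    rw [hb.leadTerm_eq, ← hcl]
    refine (single_monomial_mem_leadModule_iff (a := ⟨p, l⟩)).2 ?_
    rw [← hSR l a ha] at hc
    refine Submodule.span_induction (p := fun c' _ => c' l ∈ Ideal.span _) ?_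
      (Ideal.zero_mem _) (fun x y _ _ hx hy => Ideal.add_mem _ hx hy)
      (fun w x _ hx => Ideal.mul_mem_left _ w hx) hc
    intro c' hc'
    by_cases h0 : c' l = 0
    · rw [h0]
      exact Ideal.zero_mem _
    · obtain ⟨ζ, hζ, hlead, hlc⟩ := exists_mem_schreyerSyz_isLeadMon hSR hdiv ha hc' h0
      exact Ideal.subset_span ⟨ζ, Set.mem_iUnion.2 ⟨l, hζ⟩, _, hlead,
        ⟨rfl, tsub_le_iff_right.2 haa'⟩, hlc⟩
  · right
    have hlead : IsLeadMon o (substHom g ξ) a' := by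
      refine ⟨hx, fun b hb' => ?_⟩
      rw [substHom_eq_sum] at hb'
      obtain ⟨i, p', hp', hle⟩ := exists_le_of_modCoeff_sum_smul_ne_zero hL hb'
      exact o.le_trans hle (hbound i p' hp')
    refine ⟨hlead.ne_zero, ?_⟩
    rw [hlead.leadTerm_eq, single_monomial_mem_leadModule_iff, hval]
    refine Ideal.sum_mem _ fun i _ => ?_
    by_cases h0 : c i = 0
    · rw [h0, zero_mul]
      exact Ideal.zero_mem _
    · exact Ideal.mul_mem_left _ _
        (Ideal.subset_span ⟨g i, ⟨i, rfl⟩, L i, hL i, hcdiv i h0, rfl⟩)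

theorem finite_lcmSet (l : Fin k) : (lcmSet o g hg l).Finite := by
  refine (Set.finite_range fun J : Finset (Fin k) =>
    (⟨J.sup fun i => (leadMon o (g i) (hg i)).mon, (leadMon o (g l) (hg l)).comp⟩ :
      ModMon m n s)).subset ?_
  rintro ⟨p, c⟩ ⟨J, hJ, hc, hm⟩
  refine ⟨J, ?_⟩
  ext : 1
  · exact hm.symm
  · exact hc l hJ.1

theorem finite_schreyerSyz (SR : Fin k → ModMon m n s → Finset (Fin k → R))
    (u : Fin k → (Fin k → MixedRing R m n) → MixedRing R m n)
    (q : Fin k → (Fin k → MixedRing R m n) → Fin k → MixedRing R m n) (l : Fin k) :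
    (schreyerSyz o g hg SR u q l).Finite := by
  classical
  have h : (leadSyz o g hg SR l).Finite := by
    refine ((finite_lcmSet (o := o) (hg := hg) l).biUnion fun a _ =>
      (SR l a).finite_toSet.image fun c i =>
      if i ∈ divIndices o g hg l a then
        mixedTerm (a.mon - (leadMon o (g i) (hg i)).mon) (c i) else 0).subset ?_
    rintro ξ ⟨a, ha, c, hc, -, rfl⟩
    refine Set.mem_biUnion ha ⟨c, hc, ?_⟩
    funext i
    congr
  refine (h.image fun ξ' => u l ξ' • ξ' - ∑ i ∈ Finset.Iic l,
    q l ξ' i • (Pi.single i 1 : Fin k → MixedRing R m n)).subset ?_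
  rintro ξ ⟨ξ', hξ', rfl⟩
  exact ⟨ξ', hξ', rfl⟩

end Syzygies

/-! ### The localization -/

section Loc

variable {R : Type*} [CommRing R] {m n s k : ℕ} {S : Submonoid (MixedRing R m n)}

theorem toLoc_smul (w : MixedRing R m n) (f : Fin s → MixedRing R m n) :
    toLoc S (w • f) = algebraMap (MixedRing R m n) (Localization S) w • toLoc S f := by
  funext j
  simp [toLoc]

theorem toLoc_substHom (g : Fin k → Fin s → MixedRing R m n) (ξ : Fin k → MixedRing R m n) :
    toLoc S (substHom g ξ) = substHom (fun i => toLoc S (g i)) (toLoc S ξ) := by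
  funext j
  simp [toLoc, substHom_eq_sum, Finset.sum_apply, Algebra.smul_def]

theorem toLoc_injective (hS : S ≤ nonZeroDivisors (MixedRing R m n)) :
    Function.Injective (toLoc (k := s) S) := by
  intro f h hfh
  funext j
  exact IsLocalization.injective (Localization S) hS (congrFun hfh j)

theorem locLeadModule_mono {o : TLocalOrder m n s} {B C : Set (Fin s → Localization S)}
    (h : B ⊆ C) : locLeadModule o S B ≤ locLeadModule o S C := by
  refine Submodule.span_mono ?_
  rintro p ⟨f, hf, hp⟩
  exact ⟨f, h hf, hp⟩

theorem leadModule_le_locLeadModule {o : TLocalOrder m n s} {B : Set (Fin s → MixedRing R m n)} :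
    leadModule o B ≤ locLeadModule o S (toLoc S '' B) := by
  refine Submodule.span_mono ?_
  rintro _ ⟨f, hf, rfl⟩
  exact ⟨_, ⟨f, hf, rfl⟩, 1, one_mem _, f, by simp, rfl⟩

/-- Elements of the submodule generated by the `g_i` in the localization come, up to a factor in
`S`, from combinations of the `g_i` over `R[[t]][x]`. -/
theorem exists_smul_eq_substHom (hS : S ≤ nonZeroDivisors (MixedRing R m n))
    {g : Fin k → Fin s → MixedRing R m n} {f : Fin s → Localization S}
    (hf : f ∈ Submodule.span (Localization S) (Set.range fun i => toLoc S (g i)))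
    {v : MixedRing R m n} {h : Fin s → MixedRing R m n}
    (hv : toLoc S h = algebraMap (MixedRing R m n) (Localization S) v • f) :
    ∃ b ∈ S, ∃ ξ, b • h = substHom g ξ := by
  obtain ⟨c, rfl⟩ := (Submodule.mem_span_range_iff_exists_fun _).1 hf
  obtain ⟨b, hb⟩ := IsLocalization.exist_integer_multiples_of_finite S c
  choose w hw using hb
  refine ⟨b, b.2, fun i => v * w i, toLoc_injective hS ?_⟩
  rw [toLoc_smul, hv, toLoc_substHom, substHom_eq_sum, smul_smul, Finset.smul_sum]
  refine Finset.sum_congr rfl fun i _ => ?_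
  rw [smul_smul, toLoc, map_mul, hw, Algebra.smul_def]
  congr 1
  ring

end Loc

end

end MixedStd

theorem mainTheorem2 {R : Type*} [CommRing R] [IsNoetherianRing R] {m n s k : ℕ}
    (o : TLocalOrder m n s)
    (g : Fin k → Fin s → MixedRing R m n) (hg : ∀ i, g i ≠ 0)
    -- the chosen finite generating sets of the syzygies of the leading coefficients
    (SR : Fin k → ModMon m n s → Finset (Fin k → R))
    (hSR : ∀ l, ∀ a ∈ lcmSet o g hg l,
      Submodule.span R (SR l a : Set (Fin k → R)) = coeffSyz o g hg l a)
    -- the chosen weak divisions with remainder of the images of the elements of `syz_l`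
    (u : Fin k → (Fin k → MixedRing R m n) → MixedRing R m n)
    (q : Fin k → (Fin k → MixedRing R m n) → Fin k → MixedRing R m n)
    (r : Fin k → (Fin k → MixedRing R m n) → Fin s → MixedRing R m n)
    (hdiv : ∀ l, ∀ ξ' ∈ leadSyz o g hg SR l,
      u l ξ' ∈ unitLead R o ∧
        IsDivision o g (Finset.Iic l) (u l ξ' • substHom g ξ') (q l ξ') (r l ξ'))
    (T : Set (Fin k → MixedRing R m n))
    (hT : T ⊆ ⋃ l, schreyerSyz o g hg SR u q l)
    (hlead : leadModule (schreyer o g hg) T =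
      leadModule (schreyer o g hg) (⋃ l, schreyerSyz o g hg SR u q l))
    (hsubst : ∀ ξ ∈ T, substHom g ξ = 0) :
    IsStandardBasis o (unitLead R o)
        (Set.range fun i => toLoc (unitLead R o) (g i))
        (Submodule.span (Localization (unitLead R o))
          (Set.range fun i => toLoc (unitLead R o) (g i))) ∧
      IsStandardBasis (schreyer o g hg) (unitLead R o)
        (toLoc (unitLead R o) '' T)
        (LinearMap.ker (substHom fun i => toLoc (unitLead R o) (g i))) := by
  have hTfin : T.Finite := (Set.finite_iUnion fun l => finite_schreyerSyz SR u q l).subset hT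
  have hTker : toLoc (unitLead R o) '' T ⊆
      LinearMap.ker (substHom fun i => toLoc (unitLead R o) (g i)) := by
    rintro _ ⟨ξ, hξ, rfl⟩
    rw [SetLike.mem_coe, LinearMap.mem_ker, ← toLoc_substHom, hsubst ξ hξ]
    funext j
    simp [toLoc]
  refine ⟨⟨Set.finite_range _, Submodule.subset_span,
    le_antisymm (locLeadModule_mono Submodule.subset_span) ?_⟩, hTfin.image _, hTker,
    le_antisymm (locLeadModule_mono hTker) ?_⟩
  · refine Submodule.span_le.2 ?_
    rintro _ ⟨f, hf, v, -, h, hv, rfl⟩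
    by_cases h0 : h = 0
    · rw [h0, leadTerm_zero]
      exact Submodule.zero_mem _
    have hs : 0 < s := (exists_isLeadMon o h h0).choose.comp.pos
    obtain ⟨b, hb, ξ, hξ⟩ := exists_smul_eq_substHom (unitLead_le_nonZeroDivisors hs) hf hv
    have hξ0 : substHom g ξ ≠ 0 := hξ ▸ smul_ne_zero_of_mem_unitLead hb h0
    have hk : 0 < k := by
      rcases Nat.eq_zero_or_pos k with rfl | hk
      · exact absurd (by simp [substHom_eq_sum]) hξ0
      · exact hk
    -- the image of `ξ` does not change, up to a unit, under reduction by `T`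
    obtain ⟨w, hw, ρ, hρ, hρT⟩ := exists_weakNormalForm (o := schreyer o g hg) hTfin ξ
    rw [unitLead_schreyer hk] at hw
    have hker : substHom g (w • ξ - ρ) = 0 := by
      have : Submodule.span (MixedRing R m n) T ≤ LinearMap.ker (substHom g) :=
        Submodule.span_le.2 hsubst
      exact this hρ
    rw [map_sub, map_smul, sub_eq_zero] at hker
    have hφ : substHom g ρ ≠ 0 := hker ▸ smul_ne_zero_of_mem_unitLead hw hξ0
    have hρ0 : ρ ≠ 0 := by
      rintro rfl
      exact hφ (map_zero _)
    rcases leadTerm_mem_or hSR hdiv hρ0 with hmem | ⟨-, hmem⟩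
    · exact absurd (hlead ▸ hmem) (hρT hρ0)
    · rw [← hker, leadTerm_smul hw, ← hξ, leadTerm_smul hb] at hmem
      have := leadModule_le_locLeadModule (S := unitLead R o) hmem
      rwa [← Set.range_comp] at this
  · refine Submodule.span_le.2 ?_
    rintro _ ⟨f, hf, v, -, h, hv, rfl⟩
    by_cases h0 : h = 0
    · rw [h0, leadTerm_zero]
      exact Submodule.zero_mem _
    have hs : 0 < s := by
      obtain ⟨i⟩ : Nonempty (Fin k) := ⟨(exists_isLeadMon (schreyer o g hg) h h0).choose.comp⟩
      exact (exists_isLeadMon o (g i) (hg i)).choose.comp.pos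
    have hker : substHom g h = 0 := by
      apply toLoc_injective (unitLead_le_nonZeroDivisors (o := o) hs)
      rw [toLoc_substHom, hv, map_smul, LinearMap.mem_ker.1 hf, smul_zero]
      funext j
      simp [toLoc]
    refine leadModule_le_locLeadModule ?_
    rw [hlead]
    exact (leadTerm_mem_or hSR hdiv h0).resolve_right fun h' => h'.1 hker
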